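/- **Mermin self-testing.** Consider three parties, each with two settings $Z,X$ and outcomes $\pm1$. Write $\mathsf Z,\mathsf O,\mathsf P,\mathsf M$ for the local effects $Z=+1$, $Z=-1$, $X=+1$, $X=-1$. Let $e_1,\dots,e_{16}$ be the events $\mathsf{ZPP},\mathsf{OMP},\mathsf{OPM},\mathsf{ZMM},\mathsf{PZP},\mathsf{MOP},\mathsf{MZM},\mathsf{POM},\mathsf{PPZ},\mathsf{MMZ},\mathsf{MPO},\mathsf{PMO},\mathsf{OOO},\mathsf{ZZO},\mathsf{ZOZ},\mathsf{OZZ}$, and let $S=\sum_{i=1}^{16}p(e_i)$. A quantum realization consists of Hilbert spaces $H_A',H_B',H_C'$ (of any dimension), for each party a two-outcome projective measurement per setting (projectors of arbitrary rank, the two projectors of a setting summing to the identity), and a unit vector $\psi'\in H_A'\otimes H_B'\otimes H_C'$; then $p(e)=\langle\psi'|\Pi_e|\psi'\rangle$ with $\Pi_e=\Pi^A\otimes\Pi^B\otimes\Pi^C$. Two events are exclusive if some party uses the same setting in both with different outcomes; $G_M$ is the graph of exclusivity of $e_1,\dots,e_{16}$. 1. $G_M$ is isomorphic to the complement of the Shrikhande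 graph (the Cayley graph of $(\mathbb Z/4)^2$ with connection set $\{\pm(1,0),\pm(0,1),\pm(1,1)\}$). Its independence number is $3$, which is also the maximum of $S$ over deterministic local strategies. In every quantum realization $\langle ZXX\rangle+\langle XZX\rangle+\langle XXZ\rangle-\langle ZZZ\rangle=2S-4$. 2. The theta number of $G_M$, i.e. $\max\sum_{i=1}^{16}X_{ii}$ over positive semidefinite $X$ indexed by $\{0,\dots,16\}$ with $X_{00}=1$, $X_{ii}=X_{0i}$, and $X_{ij}=0$ for $i\sim j$, equals $4$ (for real symmetric and for complex Hermitian $X$) and equals the quantum maximum of $S$. The optimum is unique, namely $P=\begin{pmatrix}1&\tfrac14\mathbf 1^T\\ \tfrac14\mathbf 1&\tfrac14I+\tfrac18E\end{pmatrix}$, with $E$ the adjacency matrix of the complement of $G_M$. A quantum realization has $S=4$ iff its matrix $X_{ij}=\langle\psi'|\Pi_j\Pi_i|\psi'\rangle$ ($\Pi_0=I$, $\Pi_i=\Pi_{e_i}$) is optimal. 3. Let $\psi=(|000\rangle+|111\rangle)/\sqrt2$ (GHZ), each party measuring $Z:=-\sigma_x$, $X:=\sigma_y$, with unit eigenvectors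 $a_{\mathsf Z}=\tfrac1{\sqrt2}(|0\rangle-|1\rangle)$, $a_{\mathsf O}=\tfrac1{\sqrt2}(|0\rangle+|1\rangle)$, $a_{\mathsf P}=\tfrac1{\sqrt2}(|0\rangle+i|1\rangle)$, $a_{\mathsf M}=\tfrac1{\sqrt2}(|0\rangle-i|1\rangle)$. Put $v_0=\psi$, $\eta_0=1$, and for $e_i=xyz$ put $v_i=a_x\otimes a_y\otimes a_z$, $\eta_i=\tfrac12$. Then $P_{ij}=\eta_i\eta_j\langle v_j,v_i\rangle$, $\Pi_i\psi=\eta_iv_i$, and this realization has $X=P$ and $S=4$. A local unitary $U\otimes U\otimes U$ carries it to the realization in which each party measures $Z:=\sigma_z$, $X:=\sigma_x$ on the state $\tfrac12(|001\rangle+|010\rangle+|100\rangle-|111\rangle)$. 4. For this maximizer: $v_0,\dots,v_{16}$ span a space of dimension $7$ (not $8$). For a label $x$ let $\mathcal I_x$ be the set of pairs $(y,z)$ such that $xyz$ is one of the sixteen events. For every $x$, the vectors $a_y\otimes a_z$ with $(y,z)\in\mathcal I_x$ span a space of dimension $3$ (not $4$). One has $\mathcal I_{\mathsf O}=\{\mathsf{OO},\mathsf{ZZ},\mathsf{MP},\mathsf{PM}\}$,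 $\mathcal I_{\mathsf P}=\{\mathsf{ZP},\mathsf{PZ},\mathsf{OM},\mathsf{MO}\}$, the vectors $a_{\mathsf O},a_{\mathsf P}$ span $\mathbb C^2$, and $\mathsf O,\mathsf P$ are connected. Here $x\ne x'$ are joined if they are the first labels occurring in three distinct events among the sixteen whose product vectors are pairwise non-orthogonal and such that the three pairs of events each agree in exactly one party's label, the three parties being different. There are a $2$-element set $\mathcal I_B$ of labels and $2$-element sets $\mathcal I_{C,y}$ ($y\in\mathcal I_B$) with $\{y\}\times\mathcal I_{C,y}\subset\mathcal I_{\mathsf O}\cup\mathcal I_{\mathsf P}$, such that $\{a_y\}_{y\in\mathcal I_B}$ and each $\{a_z\}_{z\in\mathcal I_{C,y}}$ span $\mathbb C^2$ and the graph on $\mathcal I_B$ joining $y\neq y'$ when $\langle a_y,a_{y'}\rangle\ne0$ and $\mathcal I_{C,y}\cap\mathcal I_{C,y'}\neq\emptyset$ is connected. The local spaces are two-dimensional, and there are four labels, each label $l$ having a label $l'$ with $\langle a_l,a_{l'}\rangle=0$. 5. Self-testing: let $R$ be either of the two three-qubit realizations of item 3, with state $\psi$ and projectors $\Pi_e$. For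 every quantum realization $(\psi',\Pi')$ with $S=4$ there are Hilbert spaces $K_A,K_B,K_C$, isometries $V_X:\mathbb C^2\otimes K_X\to H_X'$ ($X=A,B,C$) and a unit vector $|junk\rangle\in K_A\otimes K_B\otimes K_C$ with $(V_A\otimes V_B\otimes V_C)(\psi\otimes|junk\rangle)=\psi'$ and $(V_A\otimes V_B\otimes V_C)(\Pi_e\psi\otimes|junk\rangle)=\Pi_e'\psi'$ for all $64$ events $e$ (in particular $v_i\otimes|junk\rangle\mapsto\eta_i^{-1}\Pi'_i\psi'$ for the GHZ realization). -/

import Mathlib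

open scoped TensorProduct ComplexOrder
open UniformSpace (Completion)

universe u v w

noncomputable section

namespace Mermin

/-- The inner product `⟨x, y⟩` of a complex inner product space, conjugate-linear in `x`. -/
abbrev ip {H : Type*} [NormedAddCommGroup H] [InnerProductSpace ℂ H] (x y : H) : ℂ :=
  @inner ℂ H InnerProductSpace.toInner x y

/-! ### Hilbert space tensor products of three factors -/

section Tensor

variable (HA HB HC : Type*)
  [NormedAddCommGroup HA] [InnerProductSpace ℂ HA]
  [NormedAddCommGroup HB] [InnerProductSpace ℂ HB]
  [NormedAddCommGroup HC] [InnerProductSpace ℂ HC]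

/-- The Hilbert space tensor product of three inner product spaces: the completion of the
algebraic tensor product for its canonical inner product. -/
def Tensor3 : Type _ := Completion (HA ⊗[ℂ] (HB ⊗[ℂ] HC))

instance : NormedAddCommGroup (Tensor3 HA HB HC) :=
  inferInstanceAs (NormedAddCommGroup (Completion (HA ⊗[ℂ] (HB ⊗[ℂ] HC))))

instance : InnerProductSpace ℂ (Tensor3 HA HB HC) :=
  inferInstanceAs (InnerProductSpace ℂ (Completion (HA ⊗[ℂ] (HB ⊗[ℂ] HC))))

instance : CompleteSpace (Tensor3 HA HB HC) :=
  inferInstanceAs (CompleteSpace (Completion (HA ⊗[ℂ] (HB ⊗[ℂ] HC))))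

variable {HA HB HC}

theorem coe_smul_aux {E : Type*} [NormedAddCommGroup E] [InnerProductSpace ℂ E]
    (c : ℂ) (x : E) : ((c • x : E) : Completion E) = c • (x : Completion E) :=
  Completion.coe_smul c x

theorem inner_coe_aux {E : Type*} [NormedAddCommGroup E] [InnerProductSpace ℂ E]
    (x y : E) : ip (x : Completion E) (y : Completion E) = ip x y :=
  Completion.inner_coe x y

/-- The canonical embedding of the algebraic tensor product. -/
def Tensor3.of : HA ⊗[ℂ] (HB ⊗[ℂ] HC) →ₗ[ℂ] Tensor3 HA HB HC where
  toFun x := (x : Completion (HA ⊗[ℂ] (HB ⊗[ℂ] HC)))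
  map_add' x y := Completion.coe_add x y
  map_smul' c x := coe_smul_aux c x

/-- The embedding is isometric. -/
theorem Tensor3.inner_of (x y : HA ⊗[ℂ] (HB ⊗[ℂ] HC)) :
    ip (Tensor3.of x) (Tensor3.of y) = ip x y :=
  inner_coe_aux x y

/-- The embedding has dense range. -/
theorem Tensor3.denseRange_of :
    DenseRange (Tensor3.of : HA ⊗[ℂ] (HB ⊗[ℂ] HC) →ₗ[ℂ] Tensor3 HA HB HC) :=
  Completion.denseRange_coe (α := HA ⊗[ℂ] (HB ⊗[ℂ] HC))

/-- The product vector `a ⊗ b ⊗ c`. -/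
def tmul3 (a : HA) (b : HB) (c : HC) : Tensor3 HA HB HC :=
  Tensor3.of (a ⊗ₜ[ℂ] (b ⊗ₜ[ℂ] c))

variable {HA' HB' HC' : Type*}
  [NormedAddCommGroup HA'] [InnerProductSpace ℂ HA']
  [NormedAddCommGroup HB'] [InnerProductSpace ℂ HB']
  [NormedAddCommGroup HC'] [InnerProductSpace ℂ HC']

/-- The bounded operator `S ⊗ T ⊗ U`. -/
def map3 (S : HA →L[ℂ] HA') (T : HB →L[ℂ] HB') (U : HC →L[ℂ] HC') :
    Tensor3 HA HB HC →L[ℂ] Tensor3 HA' HB' HC' :=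
  (TensorProduct.mapL S (TensorProduct.mapL T U)).completion

theorem map3_of (S : HA →L[ℂ] HA') (T : HB →L[ℂ] HB') (U : HC →L[ℂ] HC')
    (x : HA ⊗[ℂ] (HB ⊗[ℂ] HC)) :
    map3 S T U (Tensor3.of x) =
      Tensor3.of (TensorProduct.mapL S (TensorProduct.mapL T U) x) :=
  ContinuousLinearMap.completion_apply_coe
    (TensorProduct.mapL S (TensorProduct.mapL T U)) x

theorem map3_tmul3 (S : HA →L[ℂ] HA') (T : HB →L[ℂ] HB') (U : HC →L[ℂ] HC')
    (a : HA) (b : HB) (c : HC) :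
    map3 S T U (tmul3 a b c) = tmul3 (S a) (T b) (U c) := by
  rw [tmul3, map3_of]; rfl

theorem inner_tmul3 (a a' : HA) (b b' : HB) (c c' : HC) :
    ip (tmul3 a b c) (tmul3 a' b' c') = ip a (a') * (ip b (b') * ip c (c')) := by
  have h := Tensor3.inner_of (a ⊗ₜ[ℂ] (b ⊗ₜ[ℂ] c)) (a' ⊗ₜ[ℂ] (b' ⊗ₜ[ℂ] c'))
  refine h.trans ?_
  rw [ip, TensorProduct.inner_tmul, TensorProduct.inner_tmul]

end Tensor

/-! ### Effects, events, and quantum realizations of the `(3,2,2)` Bell scenario -/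

/-- A local effect is a pair (setting, outcome). Setting `0` is called `Z`, setting `1` is called
`X`; outcome `0` is the value `+1` and outcome `1` is the value `-1`. -/
abbrev Label : Type := Fin 2 × Fin 2

/-- The effect `Z = +1`. -/
abbrev lZ : Label := (0, 0)
/-- The effect `Z = -1`. -/
abbrev lO : Label := (0, 1)
/-- The effect `X = +1`. -/
abbrev lP : Label := (1, 0)
/-- The effect `X = -1`. -/
abbrev lM : Label := (1, 1)

/-- An event of the tripartite scenario: one effect for each of the three parties. -/
abbrev Event : Type := Label × Label × Label

/-- Two events are exclusive if some party uses the same setting in both of them and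
obtains different outcomes. -/
def Exclusive (e f : Event) : Prop :=
  (e.1.1 = f.1.1 ∧ e.1.2 ≠ f.1.2) ∨
  (e.2.1.1 = f.2.1.1 ∧ e.2.1.2 ≠ f.2.1.2) ∨
  (e.2.2.1 = f.2.2.1 ∧ e.2.2.2 ≠ f.2.2.2)

instance (e f : Event) : Decidable (Exclusive e f) := by unfold Exclusive; infer_instance

/-- The graph of exclusivity of a family of events. -/
def exclusivityGraph {V : Type*} (ev : V → Event) : SimpleGraph V :=
  SimpleGraph.fromRel fun i j => Exclusive (ev i) (ev j)

/-- The sixteen events of the Mermin witness. -/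
def merminEvent : Fin 16 → Event :=
  ![(lZ, lP, lP), (lO, lM, lP), (lO, lP, lM), (lZ, lM, lM),
    (lP, lZ, lP), (lM, lO, lP), (lM, lZ, lM), (lP, lO, lM),
    (lP, lP, lZ), (lM, lM, lZ), (lM, lP, lO), (lP, lM, lO),
    (lO, lO, lO), (lZ, lZ, lO), (lZ, lO, lZ), (lO, lZ, lZ)]

/-- The graph of exclusivity of the sixteen events. -/
def merminGraph : SimpleGraph (Fin 16) := exclusivityGraph merminEvent

/-- The Shrikhande graph: the Cayley graph of `(ℤ/4)²` with connection set
`{±(1,0), ±(0,1), ±(1,1)}`. -/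
def shrikhandeGraph : SimpleGraph (ZMod 4 × ZMod 4) :=
  SimpleGraph.fromRel fun u v => u - v ∈ ({(1, 0), (0, 1), (1, 1)} : Set (ZMod 4 × ZMod 4))

/-- The number of Mermin events that occur under a deterministic local strategy, i.e. an
assignment of an outcome to each party and each setting. -/
def localValue (s : Fin 3 → Fin 2 → Fin 2) : ℕ :=
  (Finset.univ.filter fun i : Fin 16 =>
    s 0 (merminEvent i).1.1 = (merminEvent i).1.2 ∧
    s 1 (merminEvent i).2.1.1 = (merminEvent i).2.1.2 ∧
    s 2 (merminEvent i).2.2.1 = (merminEvent i).2.2.2).card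

/-- Two projective measurements (settings) with two outcomes each on a Hilbert space; the
projectors are of arbitrary rank. -/
structure BinaryMeasurements (H : Type*) [NormedAddCommGroup H] [InnerProductSpace ℂ H]
    [CompleteSpace H] where
  proj : Label → H →L[ℂ] H
  isStarProjection : ∀ l, IsStarProjection (proj l)
  complete : ∀ x, proj (x, 0) + proj (x, 1) = 1

/-- The `±1`-valued observable of setting `x`. -/
def BinaryMeasurements.obs {H : Type*} [NormedAddCommGroup H] [InnerProductSpace ℂ H]
    [CompleteSpace H] (M : BinaryMeasurements H) (x : Fin 2) : H →L[ℂ] H :=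
  M.proj (x, 0) - M.proj (x, 1)

/-- A quantum realization of the scenario: a shared unit vector and local projective
measurements for the three parties. -/
structure Realization (HA HB HC : Type*)
    [NormedAddCommGroup HA] [InnerProductSpace ℂ HA] [CompleteSpace HA]
    [NormedAddCommGroup HB] [InnerProductSpace ℂ HB] [CompleteSpace HB]
    [NormedAddCommGroup HC] [InnerProductSpace ℂ HC] [CompleteSpace HC] where
  A : BinaryMeasurements HA
  B : BinaryMeasurements HB
  C : BinaryMeasurements HC
  state : Tensor3 HA HB HC
  norm_state : ‖state‖ = 1

section Realization

variable {HA HB HC : Type*}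
  [NormedAddCommGroup HA] [InnerProductSpace ℂ HA] [CompleteSpace HA]
  [NormedAddCommGroup HB] [InnerProductSpace ℂ HB] [CompleteSpace HB]
  [NormedAddCommGroup HC] [InnerProductSpace ℂ HC] [CompleteSpace HC]

/-- The projector of an event. -/
def Realization.eventProj (R : Realization HA HB HC) (e : Event) :
    Tensor3 HA HB HC →L[ℂ] Tensor3 HA HB HC :=
  map3 (R.A.proj e.1) (R.B.proj e.2.1) (R.C.proj e.2.2)

/-- The probability of an event. -/
def Realization.prob (R : Realization HA HB HC) (e : Event) : ℝ :=
  (ip R.state (R.eventProj e R.state)).re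

/-- The Mermin witness: the sum of the probabilities of the sixteen events. -/
def Realization.merminValue (R : Realization HA HB HC) : ℝ := ∑ i, R.prob (merminEvent i)

/-- The three-party correlator of settings `x, y, z`. -/
def Realization.correlator (R : Realization HA HB HC) (x y z : Fin 2) : ℝ :=
  (ip R.state (map3 (R.A.obs x) (R.B.obs y) (R.C.obs z) R.state)).re

/-- The expectation of the Mermin operator `ZXX + XZX + XXZ - ZZZ`. -/
def Realization.merminExpectation (R : Realization HA HB HC) : ℝ :=
  R.correlator 0 1 1 + R.correlator 1 0 1 + R.correlator 1 1 0 - R.correlator 0 0 0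

/-- The projectors `Π_0 = 1` and `Π_i`, `i = 1, …, 16`. -/
def Realization.extProj (R : Realization HA HB HC) :
    Option (Fin 16) → Tensor3 HA HB HC →L[ℂ] Tensor3 HA HB HC
  | none => 1
  | some i => R.eventProj (merminEvent i)

/-- The matrix `X i j = ⟨ψ| Π_j Π_i |ψ⟩`. -/
def Realization.momentMatrix (R : Realization HA HB HC) :
    Matrix (Option (Fin 16)) (Option (Fin 16)) ℂ :=
  Matrix.of fun i j => ip R.state (R.extProj j (R.extProj i R.state))

end Realization

/-- The set of values of the Mermin witness on quantum realizations. -/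
def quantumValues : Set ℝ :=
  {s | ∃ (HA HB HC : Type)
    (_ : NormedAddCommGroup HA) (_ : InnerProductSpace ℂ HA) (_ : CompleteSpace HA)
    (_ : NormedAddCommGroup HB) (_ : InnerProductSpace ℂ HB) (_ : CompleteSpace HB)
    (_ : NormedAddCommGroup HC) (_ : InnerProductSpace ℂ HC) (_ : CompleteSpace HC)
    (R : Realization HA HB HC), R.merminValue = s}

/-! ### The Lovász theta semidefinite program -/

section Theta

variable {V : Type*} [Fintype V] (𝕜 : Type*) [RCLike 𝕜]

/-- Feasibility for the theta program; the row and column `0` is the index `none`. -/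
def ThetaFeasible (G : SimpleGraph V) (X : Matrix (Option V) (Option V) 𝕜) : Prop :=
  X.PosSemidef ∧ X none none = 1 ∧ (∀ i, X (some i) (some i) = X none (some i)) ∧
    ∀ i j, G.Adj i j → X (some i) (some j) = 0

/-- The objective of the theta program. -/
def thetaObjective (w : V → ℝ) (X : Matrix (Option V) (Option V) 𝕜) : ℝ :=
  ∑ i, w i * RCLike.re (X (some i) (some i))

/-- The set of values attained in the theta program. The weighted theta number is its maximum. -/
def thetaValues (G : SimpleGraph V) (w : V → ℝ) : Set ℝ :=
  thetaObjective 𝕜 w '' {X | ThetaFeasible 𝕜 G X}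

/-- Optimality for the theta program. -/
def IsThetaOptimal (G : SimpleGraph V) (w : V → ℝ) (X : Matrix (Option V) (Option V) 𝕜) : Prop :=
  ThetaFeasible 𝕜 G X ∧ ∀ Y, ThetaFeasible 𝕜 G Y → thetaObjective 𝕜 w Y ≤ thetaObjective 𝕜 w X

open Classical in
/-- The matrix with blocks `1`, `(1/4) 𝟏ᵀ`, `(1/4) 𝟏` and `(1/4) I + (1/8) E`, where `E` is the
adjacency matrix of the complement of the exclusivity graph. -/
def merminPrimal : Matrix (Option (Fin 16)) (Option (Fin 16)) 𝕜
  | none, none => 1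
  | none, some _ => 1 / 4
  | some _, none => 1 / 4
  | some i, some j => ((1 / 4 : 𝕜) • (1 : Matrix (Fin 16) (Fin 16) 𝕜) +
      (1 / 8 : 𝕜) • merminGraphᶜ.adjMatrix 𝕜) i j

end Theta

/-! ### The reference realizations -/

/-- The Hilbert space of a qubit. -/
abbrev Qubit : Type := EuclideanSpace ℂ (Fin 2)

/-- The computational basis vectors `|0⟩, |1⟩`. -/
def ket (i : Fin 2) : Qubit := EuclideanSpace.single i 1

/-- The number `1/√2`. -/
def rt : ℂ := ((1 / √2 : ℝ) : ℂ)

/-- The Pauli matrices. -/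
def pauliX : Matrix (Fin 2) (Fin 2) ℂ := !![0, 1; 1, 0]
def pauliY : Matrix (Fin 2) (Fin 2) ℂ := !![0, -Complex.I; Complex.I, 0]
def pauliZ : Matrix (Fin 2) (Fin 2) ℂ := !![1, 0; 0, -1]

/-- Rank-one projective measurements of a qubit given by two orthonormal bases. -/
def BinaryMeasurements.ofVectors (v : Label → Qubit)
    (hv : ∀ x, Orthonormal ℂ fun a : Fin 2 => v (x, a)) : BinaryMeasurements Qubit where
  proj l := InnerProductSpace.rankOne ℂ (v l) (v l)
  isStarProjection l := InnerProductSpace.isStarProjection_rankOne_self ((hv l.1).1 l.2)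
  complete x := by
    have hcard : Fintype.card (Fin 2) = Module.finrank ℂ Qubit := by simp
    let b := (basisOfOrthonormalOfCardEqFinrank (hv x) hcard).toOrthonormalBasis (by simpa using hv x)
    have h := b.sum_rankOne_eq_id
    simpa [b, Fin.sum_univ_two, ContinuousLinearMap.one_def] using h

/-- Eigenvectors of `-σ_x` (labels `lZ`, `lO`) and of `σ_y` (labels `lP`, `lM`), in each case for
the eigenvalues `+1, -1`. -/
def xyVec (l : Label) : Qubit :=
  ![![!₂[rt, -rt], !₂[rt, rt]], ![!₂[rt, Complex.I * rt], !₂[rt, -(Complex.I * rt)]]] l.1 l.2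

/-- Eigenvectors of `σ_z` (labels `lZ`, `lO`) and of `σ_x` (labels `lP`, `lM`), in each case for
the eigenvalues `+1, -1`. -/
def zxVec (l : Label) : Qubit :=
  ![![!₂[1, 0], !₂[0, 1]], ![!₂[rt, rt], !₂[rt, -rt]]] l.1 l.2

theorem rt_mul_rt : rt * rt = 1 / 2 := by
  have h : (1 / √2 : ℝ) * (1 / √2) = 1 / 2 := by
    rw [div_mul_div_comm, Real.mul_self_sqrt (by norm_num)]; norm_num
  unfold rt
  rw [← Complex.ofReal_mul, h]; norm_num

theorem star_rt : (starRingEnd ℂ) rt = rt := Complex.conj_ofReal _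

theorem orthonormal_xyVec (x : Fin 2) : Orthonormal ℂ fun a : Fin 2 => xyVec (x, a) := by
  rw [orthonormal_iff_ite]
  intro i j
  have h := rt_mul_rt
  fin_cases x <;> fin_cases i <;> fin_cases j <;>
    simp [-inner_self_eq_norm_sq_to_K, xyVec, PiLp.inner_apply, Fin.sum_univ_two, star_rt] <;>
    first
      | linear_combination 2 * h
      | linear_combination rt * rt * Complex.I_mul_I
      | linear_combination 2 * h - rt * rt * Complex.I_mul_I

theorem orthonormal_zxVec (x : Fin 2) : Orthonormal ℂ fun a : Fin 2 => zxVec (x, a) := by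
  rw [orthonormal_iff_ite]
  intro i j
  have h := rt_mul_rt
  fin_cases x <;> fin_cases i <;> fin_cases j <;>
    simp [-inner_self_eq_norm_sq_to_K, zxVec, PiLp.inner_apply, Fin.sum_univ_two, star_rt] <;>
    linear_combination 2 * h

/-- The GHZ state `(|000⟩ + |111⟩)/√2`. -/
def ghzState : Tensor3 Qubit Qubit Qubit :=
  rt • (tmul3 (ket 0) (ket 0) (ket 0) + tmul3 (ket 1) (ket 1) (ket 1))

/-- The state `(|001⟩ + |010⟩ + |100⟩ - |111⟩)/2`. -/
def zxState : Tensor3 Qubit Qubit Qubit :=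
  (1 / 2 : ℂ) • (tmul3 (ket 0) (ket 0) (ket 1) + tmul3 (ket 0) (ket 1) (ket 0) +
    tmul3 (ket 1) (ket 0) (ket 0) - tmul3 (ket 1) (ket 1) (ket 1))

theorem inner_ket (i j : Fin 2) : ip (ket i) (ket j) = if i = j then 1 else 0 := by
  simp [ket, EuclideanSpace.inner_single_left]

theorem norm_ghzState : ‖ghzState‖ = 1 := by
  have h : ip ghzState ghzState = 1 := by
    have h := rt_mul_rt
    simp [-inner_self_eq_norm_sq_to_K, ghzState, inner_smul_left, inner_smul_right, inner_add_left, inner_add_right,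
      inner_tmul3, inner_ket, star_rt]
    linear_combination 2 * h
  have h1 := inner_self_eq_norm_sq (𝕜 := ℂ) ghzState
  have h2 : ‖ghzState‖ ^ 2 = 1 := h1.symm.trans (by rw [ip] at h; rw [h]; simp)
  nlinarith [norm_nonneg ghzState]

theorem norm_zxState : ‖zxState‖ = 1 := by
  have h : ip zxState zxState = 1 := by
    simp [-inner_self_eq_norm_sq_to_K, zxState, inner_smul_left, inner_smul_right, inner_add_left, inner_add_right,
      inner_sub_left, inner_sub_right, inner_tmul3, inner_ket]
    simp only [Complex.conj_ofNat]
    norm_num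
  have h1 := inner_self_eq_norm_sq (𝕜 := ℂ) zxState
  have h2 : ‖zxState‖ ^ 2 = 1 := h1.symm.trans (by rw [ip] at h; rw [h]; simp)
  nlinarith [norm_nonneg zxState]

/-- The GHZ state, each party measuring `-σ_x` (setting `0`) and `σ_y` (setting `1`). -/
def ghzReference : Realization Qubit Qubit Qubit where
  A := .ofVectors xyVec orthonormal_xyVec
  B := .ofVectors xyVec orthonormal_xyVec
  C := .ofVectors xyVec orthonormal_xyVec
  state := ghzState
  norm_state := norm_ghzState

/-- The state `(|001⟩ + |010⟩ + |100⟩ - |111⟩)/2`, each party measuring `σ_z` (setting `0`) and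
`σ_x` (setting `1`). -/
def zxReference : Realization Qubit Qubit Qubit where
  A := .ofVectors zxVec orthonormal_zxVec
  B := .ofVectors zxVec orthonormal_zxVec
  C := .ofVectors zxVec orthonormal_zxVec
  state := zxState
  norm_state := norm_zxState

/-- The vectors `v_0 = |GHZ⟩` and `v_i = a_{i_A} ⊗ b_{i_B} ⊗ c_{i_C}`. -/
def refVec : Option (Fin 16) → Tensor3 Qubit Qubit Qubit
  | none => ghzState
  | some i => tmul3 (xyVec (merminEvent i).1) (xyVec (merminEvent i).2.1)
      (xyVec (merminEvent i).2.2)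

/-- The coefficients `η_0 = 1` and `η_i = 1/2`. -/
def refEta : Option (Fin 16) → ℂ
  | none => 1
  | some _ => 1 / 2

/-! ### Self-testing -/

section SelfTest

/-- The vector `φ ⊗ junk`, for `φ` a three-qubit vector and `junk ∈ KA ⊗ KB ⊗ KC`, regrouped as a
vector of `(ℂ² ⊗ KA) ⊗ (ℂ² ⊗ KB) ⊗ (ℂ² ⊗ KC)`. -/
def withJunk {KA KB KC : Type*}
    [NormedAddCommGroup KA] [InnerProductSpace ℂ KA]
    [NormedAddCommGroup KB] [InnerProductSpace ℂ KB]
    [NormedAddCommGroup KC] [InnerProductSpace ℂ KC]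
    (φ : Tensor3 Qubit Qubit Qubit) (junk : Tensor3 KA KB KC) :
    Tensor3 (Qubit ⊗[ℂ] KA) (Qubit ⊗[ℂ] KB) (Qubit ⊗[ℂ] KC) :=
  ∑ i : Fin 2, ∑ j : Fin 2, ∑ k : Fin 2,
    ip (tmul3 (ket i) (ket j) (ket k)) φ •
      map3 (TensorProduct.mkL ℂ Qubit KA (ket i)) (TensorProduct.mkL ℂ Qubit KB (ket j))
        (TensorProduct.mkL ℂ Qubit KC (ket k)) junk

/-- On product vectors, regrouping sends `(a ⊗ b ⊗ c) ⊗ (k ⊗ l ⊗ m)` to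
`(a ⊗ k) ⊗ (b ⊗ l) ⊗ (c ⊗ m)`. -/
theorem withJunk_tmul3 {KA KB KC : Type*}
    [NormedAddCommGroup KA] [InnerProductSpace ℂ KA]
    [NormedAddCommGroup KB] [InnerProductSpace ℂ KB]
    [NormedAddCommGroup KC] [InnerProductSpace ℂ KC]
    (a b c : Qubit) (k : KA) (l : KB) (m : KC) :
    withJunk (tmul3 a b c) (tmul3 k l m) =
      tmul3 (a ⊗ₜ[ℂ] k) (b ⊗ₜ[ℂ] l) (c ⊗ₜ[ℂ] m) := by
  have expand : ∀ x : Qubit, x = x 0 • ket 0 + x 1 • ket 1 := by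
    intro x
    ext i
    fin_cases i <;> simp [ket]
  have hin : ∀ (i : Fin 2) (x : Qubit), ip (ket i) x = x i := by
    intro i x
    simp [ket, EuclideanSpace.inner_single_left]
  simp only [withJunk, inner_tmul3, hin, map3_tmul3, TensorProduct.mkL_apply_apply]
  conv_rhs => rw [expand a, expand b, expand c]
  simp only [Fin.sum_univ_two, tmul3, TensorProduct.add_tmul, TensorProduct.tmul_add,
    ← TensorProduct.smul_tmul', TensorProduct.tmul_smul, map_add, map_smul]
  module

/-- The realization `R'` is, up to local isometries and a junk state, the three-qubit
realization `R`. -/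
def LocallyEquivalent {HA : Type u} {HB : Type v} {HC : Type w}
    [NormedAddCommGroup HA] [InnerProductSpace ℂ HA] [CompleteSpace HA]
    [NormedAddCommGroup HB] [InnerProductSpace ℂ HB] [CompleteSpace HB]
    [NormedAddCommGroup HC] [InnerProductSpace ℂ HC] [CompleteSpace HC]
    (R : Realization Qubit Qubit Qubit) (R' : Realization HA HB HC) : Prop :=
  ∃ (KA : Type u) (KB : Type v) (KC : Type w)
    (_ : NormedAddCommGroup KA) (_ : InnerProductSpace ℂ KA) (_ : CompleteSpace KA)
    (_ : NormedAddCommGroup KB) (_ : InnerProductSpace ℂ KB) (_ : CompleteSpace KB)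
    (_ : NormedAddCommGroup KC) (_ : InnerProductSpace ℂ KC) (_ : CompleteSpace KC)
    (VA : Qubit ⊗[ℂ] KA →ₗᵢ[ℂ] HA) (VB : Qubit ⊗[ℂ] KB →ₗᵢ[ℂ] HB)
    (VC : Qubit ⊗[ℂ] KC →ₗᵢ[ℂ] HC) (junk : Tensor3 KA KB KC),
    ‖junk‖ = 1 ∧
    map3 VA.toContinuousLinearMap VB.toContinuousLinearMap VC.toContinuousLinearMap
      (withJunk R.state junk) = R'.state ∧
    ∀ e : Event,
      map3 VA.toContinuousLinearMap VB.toContinuousLinearMap VC.toContinuousLinearMap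
        (withJunk (R.eventProj e R.state) junk) = R'.eventProj e R'.state

/-- The quantum maximum `4` of the Mermin witness self-tests the three-qubit realization `R`:
every quantum realization attaining it is locally equivalent to `R`. -/
def MerminSelfTests (R : Realization Qubit Qubit Qubit) : Prop :=
  R.merminValue = 4 ∧
  ∀ (HA : Type u) (HB : Type v) (HC : Type w)
    [NormedAddCommGroup HA] [InnerProductSpace ℂ HA] [CompleteSpace HA]
    [NormedAddCommGroup HB] [InnerProductSpace ℂ HB] [CompleteSpace HB]
    [NormedAddCommGroup HC] [InnerProductSpace ℂ HC] [CompleteSpace HC]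
    (R' : Realization HA HB HC), R'.merminValue = 4 → LocallyEquivalent R R'

end SelfTest

/-! ### Combinatorial conditions on the product vectors -/

section Conditions

/-- The component of an event belonging to a party. -/
def component (t : Fin 3) (e : Event) : Label := ![e.1, e.2.1, e.2.2] t

/-- The events share exactly the component of party `t`. -/
def SharesOnly (t : Fin 3) (e f : Event) : Prop :=
  ∀ s, component s e = component s f ↔ s = t

/-- Three Mermin events are linked if their vectors are pairwise non-orthogonal and the three
pairs share exactly one component each, belonging to three different parties. -/
def Linked (i j k : Fin 16) : Prop :=
  i ≠ j ∧ i ≠ k ∧ j ≠ k ∧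
  ip (refVec (some i)) (refVec (some k)) ≠ 0 ∧ ip (refVec (some i)) (refVec (some j)) ≠ 0 ∧
  ip (refVec (some j)) (refVec (some k)) ≠ 0 ∧
  ∃ t₁ t₂ t₃ : Fin 3, t₁ ≠ t₂ ∧ t₁ ≠ t₃ ∧ t₂ ≠ t₃ ∧
    SharesOnly t₁ (merminEvent i) (merminEvent j) ∧
    SharesOnly t₂ (merminEvent i) (merminEvent k) ∧
    SharesOnly t₃ (merminEvent j) (merminEvent k)

/-- Two distinct labels of the first party are connected if they are the first components of
three linked events. -/
def ConnectedLabels (x x' : Label) : Prop :=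
  x ≠ x' ∧ ∃ i j k, Linked i j k ∧
    ({(merminEvent i).1, (merminEvent j).1, (merminEvent k).1} : Set Label) = {x, x'}

/-- The graph of connected labels on a set of labels of the first party. -/
def graphA (IA : Finset Label) : SimpleGraph IA :=
  SimpleGraph.fromRel fun x x' => ConnectedLabels x x'

/-- The pairs `(y, z)` for which `(x, y, z)` is one of the sixteen events. -/
def pairsBC (x : Label) : Set (Label × Label) := {p | (x, p) ∈ Set.range merminEvent}

/-- The graph on a set of labels of the second party in which two labels are joined if their
vectors are not orthogonal and their sets of labels of the third party intersect. -/
def graphB (IB : Finset Label) (IC : Label → Finset Label) : SimpleGraph IB :=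
  SimpleGraph.fromRel fun y y' => ip (xyVec y) (xyVec y') ≠ 0 ∧ (IC y ∩ IC y').Nonempty

/-- The bipartite covering condition for the vectors `b_y ⊗ c_z`, `(y, z) ∈ U`. -/
def BipartiteCondition (U : Set (Label × Label)) : Prop :=
  ∃ (IB : Finset Label) (IC : Label → Finset Label),
    IB.card = Module.finrank ℂ Qubit ∧
    (∀ y ∈ IB, (IC y).card = Module.finrank ℂ Qubit) ∧
    (∀ y ∈ IB, ∀ z ∈ IC y, (y, z) ∈ U) ∧
    Submodule.span ℂ (xyVec '' IB) = ⊤ ∧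
    (∀ y ∈ IB, Submodule.span ℂ (xyVec '' IC y) = ⊤) ∧
    (graphB IB IC).Connected

end Conditions

end Mermin

end

/-! Write `S` for the witness and `E` for the adjacency matrix of compatibility (distinct, not
exclusive). Compatibility is the Shrikhande graph, strongly regular with parameters (16, 6, 2, 2).

Upper bound. Seventeen integer vectors `dualVec`, with positive weights, have a weighted sum of
quadratic forms equal to `48 - 12 S` on every feasible matrix (`sum_dualForm`). Each form is
nonnegative, so `S ≤ 4`. The moment matrix of a quantum realization is feasible with objective `S`,
and the matrix `merminPrimal` is the Gram matrix of the vectors `η_i v_i` of the GHZ realization, so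
the bound is attained in both problems.

Uniqueness. At `S = 4` every form vanishes, so the seventeen vectors lie in the kernel of `X`. Read
on row `j`, these equations make the entries at the six neighbours of `j` a harmonic function on a
hexagon, hence constant (`ThetaFeasible.apply_of_compatible`). Hermitian symmetry and connectedness
make the diagonal constant, and one last kernel equation fixes its value (`ThetaFeasible.diag_eq`).

Self-testing does not pass through the matrix. Since the Mermin expectation is `2 S - 4`, the value
`S = 4` forces its four correlators to be extremal, so the state is stabilized up to sign by four
products of observables (`Realization.stabilizers`). Multiplying these equations shows that each
party's two observables anticommute on the state (`Realization.anticomm_state`). The kernel of the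
anticommutator is a copy of `ℂ² ⊗ K`, where `K` (`BinaryMeasurements.frame`) is its part with `Z =
1` and the observables act as `σ_z` and `σ_x`. The state lies in the product of the three copies,
and the stabilizer equations determine its qubit part (`Realization.comp_eq_smul_junk`). A local
unitary transfers the result to GHZ. -/

namespace Mermin

/-! ### Calculus of operators on the completed triple tensor product. -/

section Tensor

variable {HA HB HC HA' HB' HC' HA'' HB'' HC'' F : Type*}
  [NormedAddCommGroup HA] [InnerProductSpace ℂ HA]
  [NormedAddCommGroup HB] [InnerProductSpace ℂ HB]
  [NormedAddCommGroup HC] [InnerProductSpace ℂ HC]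
  [NormedAddCommGroup HA'] [InnerProductSpace ℂ HA']
  [NormedAddCommGroup HB'] [InnerProductSpace ℂ HB']
  [NormedAddCommGroup HC'] [InnerProductSpace ℂ HC']
  [NormedAddCommGroup HA''] [InnerProductSpace ℂ HA'']
  [NormedAddCommGroup HB''] [InnerProductSpace ℂ HB'']
  [NormedAddCommGroup HC''] [InnerProductSpace ℂ HC'']
  [NormedAddCommGroup F] [NormedSpace ℂ F]

/-- Finite sums of product vectors are dense. Scalars need no case of their own, since a factor
absorbs them. -/
theorem Tensor3.induction_on {p : Tensor3 HA HB HC → Prop} (x : Tensor3 HA HB HC)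
    (hclosed : IsClosed {x | p x}) (htmul : ∀ a b c, p (tmul3 a b c))
    (hadd : ∀ x y, p x → p y → p (x + y)) : p x := by
  refine Tensor3.denseRange_of.induction_on x hclosed fun t => ?_
  induction t with
  | zero => simpa [tmul3] using htmul 0 0 0
  | add x y hx hy => rw [map_add]; exact hadd _ _ hx hy
  | tmul a t =>
    induction t with
    | zero => simpa [tmul3] using htmul 0 0 0
    | add x y hx hy => rw [TensorProduct.tmul_add, map_add]; exact hadd _ _ hx hy
    | tmul b c => exact htmul a b c

theorem Tensor3.ext_clm {f g : Tensor3 HA HB HC →L[ℂ] F}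
    (h : ∀ a b c, f (tmul3 a b c) = g (tmul3 a b c)) : f = g := by
  ext x
  refine Tensor3.induction_on x (isClosed_eq f.continuous g.continuous) h ?_
  intro x y hx hy
  rw [map_add, map_add, hx, hy]

theorem Tensor3.eq_of_inner {x y : Tensor3 HA HB HC}
    (h : ∀ a b c, ip (tmul3 a b c) x = ip (tmul3 a b c) y) : x = y := by
  refine ext_inner_left ℂ fun t => ?_
  induction t using Tensor3.induction_on with
  | hclosed => exact isClosed_eq (by fun_prop) (by fun_prop)
  | htmul a b c => exact h a b c
  | hadd s t hs ht => rw [inner_add_left, inner_add_left, hs, ht]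

theorem tmul3_add_left (a a' : HA) (b : HB) (c : HC) :
    tmul3 (a + a') b c = tmul3 a b c + tmul3 a' b c := by
  simp [tmul3, TensorProduct.add_tmul]

theorem tmul3_add_mid (a : HA) (b b' : HB) (c : HC) :
    tmul3 a (b + b') c = tmul3 a b c + tmul3 a b' c := by
  simp [tmul3, TensorProduct.add_tmul, TensorProduct.tmul_add]

theorem tmul3_add_right (a : HA) (b : HB) (c c' : HC) :
    tmul3 a b (c + c') = tmul3 a b c + tmul3 a b c' := by
  simp [tmul3, TensorProduct.tmul_add]

theorem tmul3_smul_left (r : ℂ) (a : HA) (b : HB) (c : HC) :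
    tmul3 (r • a) b c = r • tmul3 a b c := by
  simp [tmul3, ← TensorProduct.smul_tmul']

theorem tmul3_smul_mid (r : ℂ) (a : HA) (b : HB) (c : HC) :
    tmul3 a (r • b) c = r • tmul3 a b c := by
  simp [tmul3, ← TensorProduct.smul_tmul']

theorem tmul3_smul_right (r : ℂ) (a : HA) (b : HB) (c : HC) :
    tmul3 a b (r • c) = r • tmul3 a b c := by
  simp [tmul3]

@[fun_prop]
theorem continuous_tmul3 : Continuous fun x : HA × HB × HC => tmul3 x.1 x.2.1 x.2.2 :=
  (Completion.continuous_coe (HA ⊗[ℂ] (HB ⊗[ℂ] HC))).comp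
    (f := fun x : HA × HB × HC => x.1 ⊗ₜ[ℂ] (x.2.1 ⊗ₜ[ℂ] x.2.2)) (by fun_prop)

@[fun_prop]
theorem Continuous.tmul3 {X : Type*} [TopologicalSpace X] {f : X → HA} {g : X → HB} {h : X → HC}
    (hf : Continuous f) (hg : Continuous g) (hh : Continuous h) :
    Continuous fun x => tmul3 (f x) (g x) (h x) :=
  continuous_tmul3.comp (hf.prodMk (hg.prodMk hh))

theorem map3_comp (S' : HA' →L[ℂ] HA'') (T' : HB' →L[ℂ] HB'') (U' : HC' →L[ℂ] HC'')
    (S : HA →L[ℂ] HA') (T : HB →L[ℂ] HB') (U : HC →L[ℂ] HC') :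
    (map3 S' T' U').comp (map3 S T U) = map3 (S'.comp S) (T'.comp T) (U'.comp U) :=
  Tensor3.ext_clm fun a b c => by simp [map3_tmul3]

theorem map3_map3 (S' : HA' →L[ℂ] HA'') (T' : HB' →L[ℂ] HB'') (U' : HC' →L[ℂ] HC'')
    (S : HA →L[ℂ] HA') (T : HB →L[ℂ] HB') (U : HC →L[ℂ] HC') (x : Tensor3 HA HB HC) :
    map3 S' T' U' (map3 S T U x) = map3 (S'.comp S) (T'.comp T) (U'.comp U) x := by
  rw [← map3_comp]; rfl

theorem map3_mul (S S' : HA →L[ℂ] HA) (T T' : HB →L[ℂ] HB) (U U' : HC →L[ℂ] HC) :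
    map3 S T U * map3 S' T' U' = map3 (S * S') (T * T') (U * U') := map3_comp _ _ _ _ _ _

theorem map3_one : map3 (1 : HA →L[ℂ] HA) (1 : HB →L[ℂ] HB) (1 : HC →L[ℂ] HC) = 1 :=
  Tensor3.ext_clm fun a b c => by simp [map3_tmul3]

theorem map3_add_left (S S' : HA →L[ℂ] HA') (T : HB →L[ℂ] HB') (U : HC →L[ℂ] HC') :
    map3 (S + S') T U = map3 S T U + map3 S' T U :=
  Tensor3.ext_clm fun a b c => by simp [map3_tmul3, tmul3_add_left]

theorem map3_add_mid (S : HA →L[ℂ] HA') (T T' : HB →L[ℂ] HB') (U : HC →L[ℂ] HC') :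
    map3 S (T + T') U = map3 S T U + map3 S T' U :=
  Tensor3.ext_clm fun a b c => by simp [map3_tmul3, tmul3_add_mid]

theorem map3_add_right (S : HA →L[ℂ] HA') (T : HB →L[ℂ] HB') (U U' : HC →L[ℂ] HC') :
    map3 S T (U + U') = map3 S T U + map3 S T U' :=
  Tensor3.ext_clm fun a b c => by simp [map3_tmul3, tmul3_add_right]

theorem map3_smul_left (r : ℂ) (S : HA →L[ℂ] HA') (T : HB →L[ℂ] HB') (U : HC →L[ℂ] HC') :
    map3 (r • S) T U = r • map3 S T U :=
  Tensor3.ext_clm fun a b c => by simp [map3_tmul3, tmul3_smul_left]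

theorem map3_smul_mid (r : ℂ) (S : HA →L[ℂ] HA') (T : HB →L[ℂ] HB') (U : HC →L[ℂ] HC') :
    map3 S (r • T) U = r • map3 S T U :=
  Tensor3.ext_clm fun a b c => by simp [map3_tmul3, tmul3_smul_mid]

theorem map3_smul_right (r : ℂ) (S : HA →L[ℂ] HA') (T : HB →L[ℂ] HB') (U : HC →L[ℂ] HC') :
    map3 S T (r • U) = r • map3 S T U :=
  Tensor3.ext_clm fun a b c => by simp [map3_tmul3, tmul3_smul_right]

theorem map3_sub_left (S S' : HA →L[ℂ] HA') (T : HB →L[ℂ] HB') (U : HC →L[ℂ] HC') :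
    map3 (S - S') T U = map3 S T U - map3 S' T U := by
  rw [eq_sub_iff_add_eq, ← map3_add_left, sub_add_cancel]

theorem map3_sub_mid (S : HA →L[ℂ] HA') (T T' : HB →L[ℂ] HB') (U : HC →L[ℂ] HC') :
    map3 S (T - T') U = map3 S T U - map3 S T' U := by
  rw [eq_sub_iff_add_eq, ← map3_add_mid, sub_add_cancel]

theorem map3_sub_right (S : HA →L[ℂ] HA') (T : HB →L[ℂ] HB') (U U' : HC →L[ℂ] HC') :
    map3 S T (U - U') = map3 S T U - map3 S T U' := by
  rw [eq_sub_iff_add_eq, ← map3_add_right, sub_add_cancel]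

theorem map3_zero_left (T : HB →L[ℂ] HB') (U : HC →L[ℂ] HC') :
    map3 (0 : HA →L[ℂ] HA') T U = 0 := by
  simpa using map3_smul_left 0 (0 : HA →L[ℂ] HA') T U

theorem map3_zero_mid (S : HA →L[ℂ] HA') (U : HC →L[ℂ] HC') :
    map3 S (0 : HB →L[ℂ] HB') U = 0 := by
  simpa using map3_smul_mid 0 S (0 : HB →L[ℂ] HB') U

theorem map3_zero_right (S : HA →L[ℂ] HA') (T : HB →L[ℂ] HB') :
    map3 S T (0 : HC →L[ℂ] HC') = 0 := by
  simpa using map3_smul_right 0 S T (0 : HC →L[ℂ] HC')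

/-- If `S', T', U'` are formal adjoints of `S, T, U`, then so are the tensor products. -/
theorem inner_map3_of_adjoint {S : HA →L[ℂ] HA'} {T : HB →L[ℂ] HB'} {U : HC →L[ℂ] HC'}
    {S' : HA' →L[ℂ] HA} {T' : HB' →L[ℂ] HB} {U' : HC' →L[ℂ] HC}
    (hS : ∀ x y, ip (S x) y = ip x (S' y)) (hT : ∀ x y, ip (T x) y = ip x (T' y))
    (hU : ∀ x y, ip (U x) y = ip x (U' y))
    (x : Tensor3 HA HB HC) (y : Tensor3 HA' HB' HC') :
    ip (map3 S T U x) y = ip x (map3 S' T' U' y) := by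
  induction x using Tensor3.induction_on with
  | hclosed => exact isClosed_eq (by fun_prop) (by fun_prop)
  | htmul a b c =>
    induction y using Tensor3.induction_on with
    | hclosed => exact isClosed_eq (by fun_prop) (by fun_prop)
    | htmul a' b' c' =>
      rw [map3_tmul3, map3_tmul3, inner_tmul3, inner_tmul3, hS, hT, hU]
    | hadd y z hy hz =>
      rw [ip, ip, map_add, inner_add_right, inner_add_right]
      exact congrArg₂ (· + ·) hy hz
  | hadd x z hx hz =>
    rw [ip, ip, map_add, inner_add_left, inner_add_left]
    exact congrArg₂ (· + ·) hx hz

theorem inner_map3_isometry (S : HA →ₗᵢ[ℂ] HA') (T : HB →ₗᵢ[ℂ] HB') (U : HC →ₗᵢ[ℂ] HC')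
    (x y : Tensor3 HA HB HC) :
    ip (map3 S.toContinuousLinearMap T.toContinuousLinearMap U.toContinuousLinearMap x)
      (map3 S.toContinuousLinearMap T.toContinuousLinearMap U.toContinuousLinearMap y) =
    ip x y := by
  induction x using Tensor3.induction_on with
  | hclosed => exact isClosed_eq (by fun_prop) (by fun_prop)
  | htmul a b c =>
    induction y using Tensor3.induction_on with
    | hclosed => exact isClosed_eq (by fun_prop) (by fun_prop)
    | htmul a' b' c' =>
      rw [map3_tmul3, map3_tmul3, inner_tmul3, inner_tmul3]
      simp
    | hadd y z hy hz =>
      rw [ip, ip, map_add, inner_add_right, inner_add_right]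
      exact congrArg₂ (· + ·) hy hz
  | hadd x z hx hz =>
    rw [ip, ip, map_add, inner_add_left, inner_add_left]
    exact congrArg₂ (· + ·) hx hz

section Adjoint

variable [CompleteSpace HA] [CompleteSpace HB] [CompleteSpace HC]
  [CompleteSpace HA'] [CompleteSpace HB'] [CompleteSpace HC']

theorem adjoint_map3 (S : HA →L[ℂ] HA') (T : HB →L[ℂ] HB') (U : HC →L[ℂ] HC') :
    (map3 S T U).adjoint = map3 S.adjoint T.adjoint U.adjoint := by
  symm
  rw [ContinuousLinearMap.eq_adjoint_iff]
  intro x y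
  refine inner_map3_of_adjoint ?_ ?_ ?_ x y <;> intro x y <;>
    exact ContinuousLinearMap.adjoint_inner_left _ _ _

theorem star_map3 (S : HA →L[ℂ] HA) (T : HB →L[ℂ] HB) (U : HC →L[ℂ] HC) :
    star (map3 S T U) = map3 (star S) (star T) (star U) := adjoint_map3 S T U

/-- An additive continuous function vanishing on the range of `T†` is invariant under a
self-adjoint operator that fixes the kernel of `T` pointwise. -/
theorem apply_eq_of_fixes_ker {T P : HA →L[ℂ] HA} (hP : IsSelfAdjoint P)
    (hT : ∀ x, T x = 0 → P x = x) {L : HA → ℂ} (hL : Continuous L)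
    (hadd : ∀ x y, L (x + y) = L x + L y) (hL0 : ∀ x, L (star T x) = 0) (x : HA) :
    L (P x) = L x := by
  have hmem : x - P x ∈ (T.ker)ᗮ := by
    rw [Submodule.mem_orthogonal]
    intro k hk
    have hk' : P k = k := hT k hk
    have := (ContinuousLinearMap.isSelfAdjoint_iff_isSymmetric.mp hP) k x
    simp only [ContinuousLinearMap.coe_coe] at this
    rw [inner_sub_right, ← this, hk', sub_self]
  -- The orthogonal complement of the kernel is only the closure of the range of `T†` in infinite
  -- dimension, which is why `L` has to be continuous.
  rw [ContinuousLinearMap.orthogonal_ker] at hmem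
  have h0 : L (x - P x) = 0 := by
    refine closure_minimal (s := (((star T).range : Submodule ℂ HA) : Set HA))
      (t := {x | L x = 0}) ?_ (isClosed_eq hL continuous_const) hmem
    rintro _ ⟨y, rfl⟩
    exact hL0 y
  have := hadd (P x) (x - P x)
  rw [add_sub_cancel, h0, add_zero] at this
  exact this.symm

/-- Passes from a single factor to the tensor product without describing the kernel of `T ⊗ 1 ⊗ 1`:
for fixed `b, c` the functional `a ↦ ⟨ψ, a ⊗ b ⊗ c⟩` vanishes on the range of `T†`, so it does not
see the difference between `a` and `P a`. The next two lemmas do the same in the other slots. -/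
theorem map3_left_eq_self {T P : HA →L[ℂ] HA} (hP : IsSelfAdjoint P)
    (hT : ∀ x, T x = 0 → P x = x) {ψ : Tensor3 HA HB HC}
    (hψ : map3 T (1 : HB →L[ℂ] HB) (1 : HC →L[ℂ] HC) ψ = 0) :
    map3 P (1 : HB →L[ℂ] HB) (1 : HC →L[ℂ] HC) ψ = ψ := by
  refine (Tensor3.eq_of_inner fun a b c => ?_)
  unfold ip
  rw [← ContinuousLinearMap.adjoint_inner_left, adjoint_map3,
    ← ContinuousLinearMap.star_eq_adjoint P, hP.star_eq]
  simp only [← ContinuousLinearMap.star_eq_adjoint, star_one, map3_tmul3,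
    one_apply_eq_self]
  rw [← inner_conj_symm, ← inner_conj_symm (tmul3 a b c)]
  refine congrArg _ (apply_eq_of_fixes_ker (L := fun a => ip ψ (tmul3 a b c)) hP hT
    (by fun_prop) (fun x y => by rw [tmul3_add_left]; exact inner_add_right _ _ _) (fun x => ?_) a)
  have h := ContinuousLinearMap.adjoint_inner_right (map3 T (1 : HB →L[ℂ] HB) (1 : HC →L[ℂ] HC))
    ψ (tmul3 x b c)
  rw [hψ, inner_zero_left, adjoint_map3] at h
  simpa [← ContinuousLinearMap.star_eq_adjoint, map3_tmul3] using h

theorem map3_mid_eq_self {T P : HB →L[ℂ] HB} (hP : IsSelfAdjoint P)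
    (hT : ∀ x, T x = 0 → P x = x) {ψ : Tensor3 HA HB HC}
    (hψ : map3 (1 : HA →L[ℂ] HA) T (1 : HC →L[ℂ] HC) ψ = 0) :
    map3 (1 : HA →L[ℂ] HA) P (1 : HC →L[ℂ] HC) ψ = ψ := by
  refine (Tensor3.eq_of_inner fun a b c => ?_)
  unfold ip
  rw [← ContinuousLinearMap.adjoint_inner_left, adjoint_map3,
    ← ContinuousLinearMap.star_eq_adjoint P, hP.star_eq]
  simp only [← ContinuousLinearMap.star_eq_adjoint, star_one, map3_tmul3,
    one_apply_eq_self]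
  rw [← inner_conj_symm, ← inner_conj_symm (tmul3 a b c)]
  refine congrArg _ (apply_eq_of_fixes_ker (L := fun b => ip ψ (tmul3 a b c)) hP hT
    (by fun_prop) (fun x y => by rw [tmul3_add_mid]; exact inner_add_right _ _ _) (fun x => ?_) b)
  have h := ContinuousLinearMap.adjoint_inner_right (map3 (1 : HA →L[ℂ] HA) T (1 : HC →L[ℂ] HC))
    ψ (tmul3 a x c)
  rw [hψ, inner_zero_left, adjoint_map3] at h
  simpa [← ContinuousLinearMap.star_eq_adjoint, map3_tmul3] using h

theorem map3_right_eq_self {T P : HC →L[ℂ] HC} (hP : IsSelfAdjoint P)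
    (hT : ∀ x, T x = 0 → P x = x) {ψ : Tensor3 HA HB HC}
    (hψ : map3 (1 : HA →L[ℂ] HA) (1 : HB →L[ℂ] HB) T ψ = 0) :
    map3 (1 : HA →L[ℂ] HA) (1 : HB →L[ℂ] HB) P ψ = ψ := by
  refine (Tensor3.eq_of_inner fun a b c => ?_)
  unfold ip
  rw [← ContinuousLinearMap.adjoint_inner_left, adjoint_map3,
    ← ContinuousLinearMap.star_eq_adjoint P, hP.star_eq]
  simp only [← ContinuousLinearMap.star_eq_adjoint, star_one, map3_tmul3,
    one_apply_eq_self]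
  rw [← inner_conj_symm, ← inner_conj_symm (tmul3 a b c)]
  refine congrArg _ (apply_eq_of_fixes_ker (L := fun c => ip ψ (tmul3 a b c)) hP hT
    (by fun_prop) (fun x y => by rw [tmul3_add_right]; exact inner_add_right _ _ _) (fun x => ?_) c)
  have h := ContinuousLinearMap.adjoint_inner_right (map3 (1 : HA →L[ℂ] HA) (1 : HB →L[ℂ] HB) T)
    ψ (tmul3 a b x)
  rw [hψ, inner_zero_left, adjoint_map3] at h
  simpa [← ContinuousLinearMap.star_eq_adjoint, map3_tmul3] using h

end Adjoint

/-! ### Regrouping a three-qubit vector with a junk state. -/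

/-- The regrouping map as a function of the junk state. -/
noncomputable def withJunkL (KA KB KC : Type*)
    [NormedAddCommGroup KA] [InnerProductSpace ℂ KA]
    [NormedAddCommGroup KB] [InnerProductSpace ℂ KB]
    [NormedAddCommGroup KC] [InnerProductSpace ℂ KC] (φ : Tensor3 Qubit Qubit Qubit) :
    Tensor3 KA KB KC →L[ℂ] Tensor3 (Qubit ⊗[ℂ] KA) (Qubit ⊗[ℂ] KB) (Qubit ⊗[ℂ] KC) :=
  ∑ i : Fin 2, ∑ j : Fin 2, ∑ k : Fin 2,
    ip (tmul3 (ket i) (ket j) (ket k)) φ •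
      map3 (TensorProduct.mkL ℂ Qubit KA (ket i)) (TensorProduct.mkL ℂ Qubit KB (ket j))
        (TensorProduct.mkL ℂ Qubit KC (ket k))

variable {KA KB KC : Type*}
  [NormedAddCommGroup KA] [InnerProductSpace ℂ KA]
  [NormedAddCommGroup KB] [InnerProductSpace ℂ KB]
  [NormedAddCommGroup KC] [InnerProductSpace ℂ KC]

theorem withJunkL_apply (φ : Tensor3 Qubit Qubit Qubit) (junk : Tensor3 KA KB KC) :
    withJunkL KA KB KC φ junk = withJunk φ junk := by
  simp [withJunkL, withJunk]

theorem withJunk_add_left (φ φ' : Tensor3 Qubit Qubit Qubit) (junk : Tensor3 KA KB KC) :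
    withJunk (φ + φ') junk = withJunk φ junk + withJunk φ' junk := by
  simp only [withJunk, ip, inner_add_right, add_smul, Finset.sum_add_distrib]

theorem continuous_withJunk_left (junk : Tensor3 KA KB KC) :
    Continuous fun φ => withJunk φ junk := by
  unfold withJunk ip
  fun_prop

theorem continuous_withJunk_right (φ : Tensor3 Qubit Qubit Qubit) :
    Continuous fun junk : Tensor3 KA KB KC => withJunk φ junk := by
  exact (withJunkL KA KB KC φ).continuous.congr (withJunkL_apply φ)

/-- Continuous linear maps of a regrouped vector are determined by their values on products. -/
theorem withJunk_intertwine
    {f : Tensor3 (Qubit ⊗[ℂ] KA) (Qubit ⊗[ℂ] KB) (Qubit ⊗[ℂ] KC) →L[ℂ] F}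
    {g : Tensor3 (Qubit ⊗[ℂ] KA) (Qubit ⊗[ℂ] KB) (Qubit ⊗[ℂ] KC) →L[ℂ] F}
    {S T U : Qubit →L[ℂ] Qubit}
    (h : ∀ a b c k l m, f (tmul3 (S a ⊗ₜ[ℂ] k) (T b ⊗ₜ[ℂ] l) (U c ⊗ₜ[ℂ] m)) =
      g (tmul3 (a ⊗ₜ[ℂ] k) (b ⊗ₜ[ℂ] l) (c ⊗ₜ[ℂ] m)))
    (φ : Tensor3 Qubit Qubit Qubit) (junk : Tensor3 KA KB KC) :
    f (withJunk (map3 S T U φ) junk) = g (withJunk φ junk) := by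
  induction φ using Tensor3.induction_on with
  | hclosed =>
    exact isClosed_eq (f.continuous.comp ((continuous_withJunk_left junk).comp (by fun_prop)))
      (g.continuous.comp (continuous_withJunk_left junk))
  | htmul a b c =>
    induction junk using Tensor3.induction_on with
    | hclosed =>
      exact isClosed_eq (f.continuous.comp (continuous_withJunk_right _))
        (g.continuous.comp (continuous_withJunk_right _))
    | htmul k l m => rw [map3_tmul3, withJunk_tmul3, withJunk_tmul3, h]
    | hadd x y hx hy =>
      simp only [← withJunkL_apply, map_add] at hx hy ⊢
      rw [hx, hy]
  | hadd x y hx hy =>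
    rw [map_add, withJunk_add_left, withJunk_add_left, map_add, map_add, hx, hy]

end Tensor

/-! ### The theta number: a sum-of-squares bound. -/

section Theta

/-- Two distinct Mermin events that are not exclusive. -/
def Compatible (i j : Fin 16) : Prop :=
  i ≠ j ∧ ¬ Exclusive (merminEvent i) (merminEvent j)

instance (i j : Fin 16) : Decidable (Compatible i j) := by unfold Compatible; infer_instance

theorem Exclusive.symm {e f : Event} (h : Exclusive e f) : Exclusive f e := by
  unfold Exclusive at *
  tauto

theorem merminGraph_adj {i j : Fin 16} :
    merminGraph.Adj i j ↔ i ≠ j ∧ Exclusive (merminEvent i) (merminEvent j) := by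
  simp only [merminGraph, exclusivityGraph, SimpleGraph.fromRel_adj]
  exact and_congr_right fun _ => ⟨fun h => h.elim id Exclusive.symm, Or.inl⟩

theorem merminGraph_compl_adj {i j : Fin 16} : merminGraphᶜ.Adj i j ↔ Compatible i j := by
  rw [SimpleGraph.compl_adj, merminGraph_adj, Compatible]
  tauto

/-- The seventeen integer vectors whose squares form the dual certificate. -/
def dualVec : Option (Fin 16) → Option (Fin 16) → ℤ
  | none, none => 4
  | none, some _ => -1
  | some _, none => -1
  | some j, some i => if i = j then -2 else if Compatible j i then 1 else 0

/-- The weights of the dual certificate. -/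
def dualWeight : Option (Fin 16) → ℤ
  | none => 2
  | some _ => 1

/-- The dual certificate. -/
def dualCert (a b : Option (Fin 16)) : ℤ := ∑ k, dualWeight k * (dualVec k a * dualVec k b)

/-- The values of the certificate reflect the parameters (16, 6, 2, 2): `48 = 2·16 + 16`, `-12 = -8
- (6 - 2)`, `12 = 2 + 4 + 6`, and for compatible events `0 = 2 - 4 + 2`, the last term counting
common neighbours. Distinct exclusive events need no value, because `X` vanishes there. -/
theorem dualCert_none_none : dualCert none none = 48 := by decide +kernel

theorem dualCert_none_some (i : Fin 16) : dualCert none (some i) = -12 := by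
  revert i; decide +kernel

theorem dualCert_some_none (i : Fin 16) : dualCert (some i) none = -12 := by
  revert i; decide +kernel

theorem dualCert_diag (i : Fin 16) : dualCert (some i) (some i) = 12 := by
  revert i; decide +kernel

theorem dualCert_compatible (i j : Fin 16) (h : Compatible i j) :
    dualCert (some i) (some j) = 0 := by
  revert i j; decide +kernel

variable {𝕜 : Type*} [RCLike 𝕜] {X : Matrix (Option (Fin 16)) (Option (Fin 16)) 𝕜}

/-- Both entries agree with the diagonal entry, which is real because `X` is Hermitian. -/
theorem ThetaFeasible.apply_comm_none (h : ThetaFeasible 𝕜 merminGraph X) (i : Fin 16) :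
    X (some i) none = X none (some i) := by
  have h1 := h.1.isHermitian.apply (some i) none
  have h2 := h.1.isHermitian.apply (some i) (some i)
  rw [← h1, ← h.2.2.1, h2]

theorem ThetaFeasible.apply_eq_zero (h : ThetaFeasible 𝕜 merminGraph X) {i j : Fin 16}
    (hne : i ≠ j) (hc : ¬ Compatible i j) : X (some i) (some j) = 0 :=
  h.2.2.2 i j (merminGraph_adj.2 ⟨hne, not_not.1 fun he => hc ⟨hne, he⟩⟩)

/-- The quadratic form of `X` at the `k`-th dual vector. -/
noncomputable def dualForm (X : Matrix (Option (Fin 16)) (Option (Fin 16)) 𝕜)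
    (k : Option (Fin 16)) : 𝕜 :=
  ∑ a, ∑ b, ((dualVec k a : ℤ) : 𝕜) * X a b * ((dualVec k b : ℤ) : 𝕜)

theorem dualForm_eq_dotProduct (X : Matrix (Option (Fin 16)) (Option (Fin 16)) 𝕜)
    (k : Option (Fin 16)) :
    dualForm X k = dotProduct (star fun a => ((dualVec k a : ℤ) : 𝕜))
      (X.mulVec fun a => ((dualVec k a : ℤ) : 𝕜)) := by
  simp only [dualForm, dotProduct, Matrix.mulVec, Finset.mul_sum, mul_assoc]
  refine Finset.sum_congr rfl fun a _ => Finset.sum_congr rfl fun b _ => ?_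
  simp

/-- The border contributes `-24 ∑ X i i` and the diagonal `12 ∑ X i i`; off the diagonal either the
certificate or `X` is zero. -/
theorem sum_dualForm (h : ThetaFeasible 𝕜 merminGraph X) :
    ∑ k, ((dualWeight k : ℤ) : 𝕜) * dualForm X k = 48 - 12 * ∑ i, X (some i) (some i) := by
  have h1 : ∑ k, ((dualWeight k : ℤ) : 𝕜) * dualForm X k =
      ∑ a, ∑ b, ((dualCert a b : ℤ) : 𝕜) * X a b := by
    simp only [dualForm, dualCert, Finset.mul_sum, Int.cast_sum, Finset.sum_mul]
    rw [Finset.sum_comm]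
    refine Finset.sum_congr rfl fun a _ => ?_
    rw [Finset.sum_comm]
    refine Finset.sum_congr rfl fun b _ => Finset.sum_congr rfl fun k _ => ?_
    push_cast
    ring
  have h2 (i : Fin 16) : ∑ j, ((dualCert (some i) (some j) : ℤ) : 𝕜) * X (some i) (some j) =
      12 * X (some i) (some i) := by
    rw [Finset.sum_eq_single i]
    · rw [dualCert_diag]; norm_num
    · intro j _ hj
      by_cases hc : Compatible i j
      · rw [dualCert_compatible i j hc]; simp
      · rw [h.apply_eq_zero hj.symm hc, mul_zero]
    · simp
  rw [h1, Fintype.sum_option]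
  simp only [Fintype.sum_option, dualCert_none_none, dualCert_none_some, dualCert_some_none, h2,
    h.2.1, h.apply_comm_none, Finset.sum_add_distrib, ← h.2.2.1, ← Finset.mul_sum]
  push_cast
  ring

theorem thetaObjective_one (X : Matrix (Option (Fin 16)) (Option (Fin 16)) 𝕜) :
    thetaObjective 𝕜 1 X = RCLike.re (∑ i, X (some i) (some i)) := by
  simp [thetaObjective]

theorem re_dualForm_nonneg (h : ThetaFeasible 𝕜 merminGraph X) (k : Option (Fin 16)) :
    0 ≤ RCLike.re (dualForm X k) := by
  rw [dualForm_eq_dotProduct]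
  exact h.1.re_dotProduct_nonneg _

theorem sum_re_dualForm (h : ThetaFeasible 𝕜 merminGraph X) :
    ∑ k, ((dualWeight k : ℤ) : ℝ) * RCLike.re (dualForm X k) =
      48 - 12 * thetaObjective 𝕜 1 X := by
  have h1 := congrArg RCLike.re (sum_dualForm h)
  rw [thetaObjective_one]
  have h2 (z : 𝕜) (n : ℤ) : RCLike.re ((n : 𝕜) * z) = n * RCLike.re z := by
    rw [← RCLike.ofReal_intCast, RCLike.re_ofReal_mul]
  have h3 : RCLike.re (48 - 12 * ∑ i, X (some i) (some i) : 𝕜) =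
      48 - 12 * RCLike.re (∑ i, X (some i) (some i)) := by
    have := h2 (∑ i, X (some i) (some i)) 12
    push_cast at this
    rw [map_sub, this]
    have h48 := RCLike.natCast_re (K := 𝕜) 48
    push_cast at h48
    rw [h48]
  rw [← h3, ← h1, map_sum]
  simp only [h2]

theorem dualWeight_pos (k : Option (Fin 16)) : (0 : ℝ) < (dualWeight k : ℤ) := by
  cases k <;> norm_num [dualWeight]

theorem ThetaFeasible.objective_le (h : ThetaFeasible 𝕜 merminGraph X) :
    thetaObjective 𝕜 1 X ≤ 4 := by
  have h1 := sum_re_dualForm h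
  have h2 : 0 ≤ ∑ k, ((dualWeight k : ℤ) : ℝ) * RCLike.re (dualForm X k) :=
    Finset.sum_nonneg fun k _ => mul_nonneg (dualWeight_pos k).le (re_dualForm_nonneg h k)
  linarith

/-- Complementary slackness: positively weighted nonnegative forms summing to zero all vanish, and a
null vector of a positive semidefinite form lies in the kernel. -/
theorem ThetaFeasible.mulVec_dualVec (h : ThetaFeasible 𝕜 merminGraph X)
    (hX : thetaObjective 𝕜 1 X = 4) (k : Option (Fin 16)) :
    X.mulVec (fun a => ((dualVec k a : ℤ) : 𝕜)) = 0 := by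
  have h1 := sum_re_dualForm h
  rw [hX, show (48 - 12 * 4 : ℝ) = 0 by norm_num] at h1
  rw [Finset.sum_eq_zero_iff_of_nonneg fun k _ =>
    mul_nonneg (dualWeight_pos k).le (re_dualForm_nonneg h k)] at h1
  have h2 := (mul_eq_zero.1 (h1 k (Finset.mem_univ k))).resolve_left (dualWeight_pos k).ne'
  rw [← h.1.dotProduct_mulVec_zero_iff, ← dualForm_eq_dotProduct]
  have h3 := h.1.dotProduct_mulVec_nonneg fun a => ((dualVec k a : ℤ) : 𝕜)
  rw [← dualForm_eq_dotProduct, RCLike.nonneg_iff] at h3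
  exact RCLike.ext (by simpa using h2) (by simpa using h3.2)

/-! ### Uniqueness of the optimum. -/

/-- The hexagon formed by the six events compatible with a given one. -/
def hexagon : Fin 16 → Fin 6 → Fin 16 :=
  ![![4, 8, 14, 5, 10, 13], ![4, 11, 12, 5, 9, 15], ![6, 10, 12, 7, 8, 15],
    ![6, 9, 14, 7, 11, 13], ![0, 8, 15, 1, 11, 13], ![0, 10, 12, 1, 9, 14],
    ![2, 10, 13, 3, 9, 15], ![2, 8, 14, 3, 11, 12], ![0, 4, 15, 2, 7, 14],
    ![1, 5, 14, 3, 6, 15], ![0, 5, 12, 2, 6, 13], ![1, 4, 13, 3, 7, 12],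
    ![1, 5, 10, 2, 7, 11], ![0, 4, 11, 3, 6, 10], ![0, 5, 9, 3, 7, 8], ![1, 4, 8, 2, 6, 9]]

theorem compatible_iff_exists_hexagon (j i : Fin 16) :
    Compatible j i ↔ ∃ m, hexagon j m = i := by
  revert j i; decide +kernel

theorem filter_compatible (j : Fin 16) :
    Finset.univ.filter (fun i => Compatible j i) = Finset.univ.image (hexagon j) := by
  revert j; decide +kernel

theorem hexagon_injective (j : Fin 16) : Function.Injective (hexagon j) := by
  revert j; decide +kernel

/-- Inside the closed neighbourhood of `j`, the neighbours of the `m`-th hexagon vertex are `j` and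
the two adjacent hexagon vertices. That the neighbourhood is one 6-cycle, and not two triangles,
separates the Shrikhande graph from the 4 × 4 rook's graph with the same parameters. -/
theorem filter_compatible_compatible (j : Fin 16) (m : Fin 6) :
    Finset.univ.filter (fun i => Compatible (hexagon j m) i ∧ (i = j ∨ Compatible j i)) =
      {j, hexagon j (m - 1), hexagon j (m + 1)} := by
  revert j m; decide +kernel

theorem hexagon_ne (j : Fin 16) (m : Fin 6) : hexagon j (m - 1) ≠ j ∧ hexagon j (m + 1) ≠ j ∧
    hexagon j (m - 1) ≠ hexagon j (m + 1) := by
  revert j m; decide +kernel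

theorem Compatible.symm {i j : Fin 16} (h : Compatible i j) : Compatible j i :=
  ⟨h.1.symm, fun h' => h.2 h'.symm⟩

/-- A function on a cycle equal to the mean of its two neighbours everywhere is constant; six equal
terms with sum `3 d` are each `d / 2`. -/
theorem eq_of_harmonic_hexagon {a : Fin 6 → 𝕜} {d : 𝕜} (hsum : ∑ m, a m = 3 * d)
    (h : ∀ m, a (m - 1) + a (m + 1) = 2 * a m) (m : Fin 6) : a m = d / 2 := by
  have h0 := h 0
  have h1 := h 1
  have h2 := h 2
  have h3 := h 3
  have h4 := h 4
  have h5 := h 5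
  simp only [Fin.sum_univ_six] at hsum
  simp only [show (0 - 1 : Fin 6) = 5 from rfl, show (0 + 1 : Fin 6) = 1 from rfl,
    show (1 - 1 : Fin 6) = 0 from rfl, show (1 + 1 : Fin 6) = 2 from rfl,
    show (2 - 1 : Fin 6) = 1 from rfl, show (2 + 1 : Fin 6) = 3 from rfl,
    show (3 - 1 : Fin 6) = 2 from rfl, show (3 + 1 : Fin 6) = 4 from rfl,
    show (4 - 1 : Fin 6) = 3 from rfl, show (4 + 1 : Fin 6) = 5 from rfl,
    show (5 - 1 : Fin 6) = 4 from rfl, show (5 + 1 : Fin 6) = 0 from rfl] at h0 h1 h2 h3 h4 h5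
  fin_cases m <;> simp <;> grind

theorem ThetaFeasible.sum_compatible (h : ThetaFeasible 𝕜 merminGraph X)
    (hX : thetaObjective 𝕜 1 X = 4) (a : Option (Fin 16)) (k : Fin 16) :
    ∑ i with Compatible k i, X a (some i) = 2 * X a (some k) + X a none := by
  have h1 := congrFun (h.mulVec_dualVec hX (some k)) a
  simp only [Matrix.mulVec, dotProduct, Fintype.sum_option, dualVec] at h1
  have h2 : ∑ i, X a (some i) * ((if i = k then (-2) else if Compatible k i then 1 else 0 : ℤ) : 𝕜)
      = ∑ i with Compatible k i, X a (some i) - 2 * X a (some k) := by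
    rw [Finset.sum_filter, eq_sub_iff_add_eq]
    have : 2 * X a (some k) = ∑ i, if i = k then 2 * X a (some i) else 0 := by simp
    rw [this, ← Finset.sum_add_distrib]
    refine Finset.sum_congr rfl fun i _ => ?_
    split_ifs with hi hc
    · exact absurd hi hc.1.symm
    · push_cast; ring
    · push_cast; ring
    · simp
  rw [h2] at h1
  push_cast at h1
  simp only [Pi.zero_apply] at h1
  linear_combination h1

/-- In row `j`, with `d` the diagonal entry, the kernel equation at `j` says that the hexagon
entries sum to `3 d`. At a hexagon vertex, `d` occurs on both sides, from `j` itself and from the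
border, and cancels; what remains is harmonicity. -/
theorem ThetaFeasible.apply_of_compatible (h : ThetaFeasible 𝕜 merminGraph X)
    (hX : thetaObjective 𝕜 1 X = 4) {j i : Fin 16} (hc : Compatible j i) :
    X (some j) (some i) = X (some j) (some j) / 2 := by
  obtain ⟨m, rfl⟩ := (compatible_iff_exists_hexagon j i).1 hc
  have hnone : X (some j) none = X (some j) (some j) := by
    rw [h.apply_comm_none, h.2.2.1]
  refine eq_of_harmonic_hexagon (a := fun m => X (some j) (some (hexagon j m))) ?_ ?_ m
  · have := h.sum_compatible hX (some j) j
    rw [filter_compatible, Finset.sum_image fun _ _ _ _ h => hexagon_injective j h, hnone] at this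
    rw [this]; ring
  · intro m
    have h1 := h.sum_compatible hX (some j) (hexagon j m)
    have h2 : ∑ i with Compatible (hexagon j m) i, X (some j) (some i) =
        ∑ i with Compatible (hexagon j m) i ∧ (i = j ∨ Compatible j i), X (some j) (some i) := by
      symm
      refine Finset.sum_subset (fun i => by simp +contextual) fun i hi hi' => ?_
      simp only [Finset.mem_filter, Finset.mem_univ, true_and, not_and, not_or] at hi hi'
      -- Events outside the closed neighbourhood of `j` are exclusive to `j`, so they drop out of
      -- row `j`.
      exact h.apply_eq_zero (Ne.symm (hi' hi).1) (hi' hi).2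
    obtain ⟨n1, n2, n3⟩ := hexagon_ne j m
    rw [h2, filter_compatible_compatible, Finset.sum_insert (by simp [n1.symm, n2.symm]),
      Finset.sum_pair n3, hnone] at h1
    linear_combination h1

/-- For compatible `i, j` the entry `X i j` is half of both diagonal entries, so these agree;
connectedness spreads this to all events. The kernel vector `(4, -1, …, -1)` on row `0` then gives
`16 d = 4`. -/
theorem ThetaFeasible.diag_eq (h : ThetaFeasible 𝕜 merminGraph X)
    (hX : thetaObjective 𝕜 1 X = 4) (i : Fin 16) : X (some i) (some i) = 1 / 4 := by
  have hc {i j : Fin 16} (hij : Compatible i j) : X (some i) (some i) = X (some j) (some j) := by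
    have h1 := h.apply_of_compatible hX hij
    have h2 := h.apply_of_compatible hX hij.symm
    have h3 := h.1.isHermitian.apply (some i) (some j)
    have h4 := h.1.isHermitian.apply (some j) (some j)
    rw [h2, h1, star_div₀, h4] at h3
    simp only [star_ofNat] at h3
    linear_combination (-2) * h3
  have hconn : ∀ i j : Fin 16, ∃ k l, (Compatible i k ∨ i = k) ∧ (Compatible k l ∨ k = l) ∧
      (Compatible l j ∨ l = j) := by decide +kernel
  have hall (i j : Fin 16) : X (some i) (some i) = X (some j) (some j) := by
    obtain ⟨k, l, h1, h2, h3⟩ := hconn i j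
    exact ((h1.elim hc (by rintro rfl; rfl)).trans (h2.elim hc (by rintro rfl; rfl))).trans
      (h3.elim hc (by rintro rfl; rfl))
  have h1 := congrFun (h.mulVec_dualVec hX none) none
  simp only [Matrix.mulVec, dotProduct, Fintype.sum_option, dualVec, h.2.1, ← h.2.2.1,
    fun j => hall j i, Pi.zero_apply] at h1
  simp only [Finset.sum_const, Finset.card_univ, Fintype.card_fin] at h1
  push_cast at h1
  simp only [nsmul_eq_mul] at h1
  push_cast at h1
  linear_combination (-1 / 16) * h1

open Classical in
theorem merminPrimal_some_some (i j : Fin 16) : merminPrimal 𝕜 (some i) (some j) =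
    if i = j then 1 / 4 else if Compatible i j then 1 / 8 else 0 := by
  rw [merminPrimal, Matrix.add_apply, Matrix.smul_apply, Matrix.smul_apply,
    SimpleGraph.adjMatrix_apply, Matrix.one_apply]
  simp only [merminGraph_compl_adj]
  split_ifs with h1 h2 <;> simp_all [Compatible]

theorem ThetaFeasible.eq_merminPrimal (h : ThetaFeasible 𝕜 merminGraph X)
    (hX : thetaObjective 𝕜 1 X = 4) : X = merminPrimal 𝕜 := by
  ext a b
  cases a <;> cases b
  · rw [h.2.1, merminPrimal]
  · rw [← h.2.2.1, h.diag_eq hX, merminPrimal]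
  · rw [h.apply_comm_none, ← h.2.2.1, h.diag_eq hX, merminPrimal]
  · rw [merminPrimal_some_some]
    split_ifs with h1 h2
    · rw [h1, h.diag_eq hX]
    · rw [h.apply_of_compatible hX h2, h.diag_eq hX]; norm_num
    · exact h.apply_eq_zero h1 h2

theorem thetaObjective_merminPrimal : thetaObjective 𝕜 1 (merminPrimal 𝕜) = 4 := by
  have h2 := RCLike.ofReal_re (K := 𝕜) (1 / 4)
  push_cast at h2
  simp only [thetaObjective, merminPrimal_some_some, if_true, h2]
  norm_num

/-- Positivity is a hypothesis here because the bound and the uniqueness hold over either field at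
once, whereas positivity comes later from explicit complex vectors, separately for `ℂ` and `ℝ`. -/
theorem thetaFeasible_merminPrimal (hpos : (merminPrimal 𝕜).PosSemidef) :
    ThetaFeasible 𝕜 merminGraph (merminPrimal 𝕜) := by
  refine ⟨hpos, rfl, fun i => ?_, fun i j hij => ?_⟩
  · rw [merminPrimal_some_some, if_pos rfl]; rfl
  · rw [merminPrimal_some_some, if_neg hij.ne, if_neg]
    exact fun h => h.2 (merminGraph_adj.1 hij).2

theorem isThetaOptimal_iff_objective (hpos : (merminPrimal 𝕜).PosSemidef)
    (h : ThetaFeasible 𝕜 merminGraph X) :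
    IsThetaOptimal 𝕜 merminGraph 1 X ↔ thetaObjective 𝕜 1 X = 4 := by
  constructor
  · intro hX
    refine le_antisymm h.objective_le ?_
    rw [← thetaObjective_merminPrimal (𝕜 := 𝕜)]
    exact hX.2 _ (thetaFeasible_merminPrimal hpos)
  · intro hX
    exact ⟨h, fun Y hY => hX ▸ hY.objective_le⟩

theorem isThetaOptimal_iff (hpos : (merminPrimal 𝕜).PosSemidef) :
    IsThetaOptimal 𝕜 merminGraph 1 X ↔ X = merminPrimal 𝕜 := by
  constructor
  · intro hX
    exact hX.1.eq_merminPrimal ((isThetaOptimal_iff_objective hpos hX.1).1 hX)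
  · rintro rfl
    exact (isThetaOptimal_iff_objective hpos (thetaFeasible_merminPrimal hpos)).2
      thetaObjective_merminPrimal

theorem isGreatest_thetaValues (hpos : (merminPrimal 𝕜).PosSemidef) :
    IsGreatest (thetaValues 𝕜 merminGraph 1) 4 := by
  refine ⟨⟨_, thetaFeasible_merminPrimal hpos, thetaObjective_merminPrimal⟩, ?_⟩
  rintro _ ⟨X, hX, rfl⟩
  exact hX.objective_le

end Theta

/-! ### The Shrikhande graph, the independence number and the local bound. -/

/-- The coordinates in `(ℤ/4)²` of the Mermin events. -/
def shrikhandeCoord : Fin 16 → ZMod 4 × ZMod 4 :=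
  ![(0, 0), (0, 2), (2, 0), (2, 2), (0, 1), (0, 3), (2, 1), (2, 3), (3, 0), (3, 2), (1, 0), (1, 2),
    (1, 3), (1, 1), (3, 3), (3, 1)]

theorem bijective_shrikhandeCoord : Function.Bijective shrikhandeCoord := by
  rw [Fintype.bijective_iff_injective_and_card]
  exact ⟨by unfold Function.Injective; decide +kernel, rfl⟩

theorem shrikhandeGraph_adj (u v : ZMod 4 × ZMod 4) : shrikhandeGraph.Adj u v ↔
    u ≠ v ∧ ((u - v = (1, 0) ∨ u - v = (0, 1) ∨ u - v = (1, 1)) ∨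
      (v - u = (1, 0) ∨ v - u = (0, 1) ∨ v - u = (1, 1))) := by
  simp [shrikhandeGraph, SimpleGraph.fromRel_adj]

theorem shrikhandeGraph_adj_coord (i j : Fin 16) :
    shrikhandeGraph.Adj (shrikhandeCoord i) (shrikhandeCoord j) ↔ Compatible i j := by
  rw [shrikhandeGraph_adj]
  revert i j
  decide +kernel

theorem nonempty_iso_shrikhandeGraph_compl : Nonempty (merminGraph ≃g shrikhandeGraphᶜ) := by
  refine ⟨⟨Equiv.ofBijective _ bijective_shrikhandeCoord, fun {i j} => ?_⟩⟩
  rw [Equiv.ofBijective_apply, Equiv.ofBijective_apply, SimpleGraph.compl_adj,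
    shrikhandeGraph_adj_coord, bijective_shrikhandeCoord.1.ne_iff, merminGraph_adj, Compatible,
    not_and, not_not]
  exact ⟨fun h => ⟨h.1, h.2 h.1⟩, fun h => ⟨h.1, fun _ => h.2⟩⟩

theorem compatible_of_isIndepSet {s : Set (Fin 16)} (hs : merminGraph.IsIndepSet s) {i j : Fin 16}
    (hi : i ∈ s) (hj : j ∈ s) (hij : i ≠ j) : Compatible i j :=
  ⟨hij, fun h => hs hi hj hij (merminGraph_adj.2 ⟨hij, h⟩)⟩

theorem not_four_compatible : ∀ i j, Compatible i j → ∀ k, Compatible i k → Compatible j k →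
    ∀ l, Compatible i l → Compatible j l → ¬ Compatible k l := by
  decide +kernel

theorem indepNum_merminGraph : merminGraph.indepNum = 3 := by
  refine le_antisymm ?_ ?_
  · obtain ⟨s, hs, hcard⟩ := merminGraph.exists_isNIndepSet_indepNum
    rw [← hcard]
    by_contra! hlt
    obtain ⟨t, hts, ht⟩ := Finset.exists_subset_card_eq (show 4 ≤ s.card from hlt)
    obtain ⟨a, b, c, d, hab, hac, had, hbc, hbd, hcd, rfl⟩ := Finset.card_eq_four.1 ht
    have hmem {x : Fin 16} (hx : x ∈ ({a, b, c, d} : Finset (Fin 16))) : x ∈ (s : Set (Fin 16)) :=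
      hts hx
    have ha := hmem (x := a) (by simp)
    have hb := hmem (x := b) (by simp)
    have hc := hmem (x := c) (by simp)
    have hd := hmem (x := d) (by simp)
    have hcomp {i j : Fin 16} (hi : i ∈ (s : Set (Fin 16))) (hj : j ∈ (s : Set (Fin 16)))
      (hij : i ≠ j) := compatible_of_isIndepSet hs hi hj hij
    exact not_four_compatible a b (hcomp ha hb hab) c (hcomp ha hc hac) (hcomp hb hc hbc) d
      (hcomp ha hd had) (hcomp hb hd hbd) (hcomp hc hd hcd)
  -- The events `ZPP`, `PZP` and `PPZ` are pairwise compatible.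
  · have h : merminGraph.IsIndepSet (({0, 4, 8} : Finset (Fin 16)) : Set (Fin 16)) := by
      have hc : ∀ i ∈ ({0, 4, 8} : Finset (Fin 16)), ∀ j ∈ ({0, 4, 8} : Finset (Fin 16)),
          i ≠ j → Compatible i j := by decide +kernel
      intro i hi j hj hij hadj
      exact (hc i hi j hj hij).2 (merminGraph_adj.1 hadj).2
    exact h.card_le_indepNum

theorem isGreatest_localValue : IsGreatest (Set.range localValue) 3 := by
  constructor
  -- Under this strategy exactly `OMP`, `PMO` and `OOO` occur.
  · exact ⟨![![1, 0], ![1, 1], ![1, 0]], by decide +kernel⟩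
  · rintro _ ⟨s, rfl⟩
    have h : ∀ a b c d e f : Fin 2, localValue ![![a, b], ![c, d], ![e, f]] ≤ 3 := by
      decide +kernel
    have hs : s = ![![s 0 0, s 0 1], ![s 1 0, s 1 1], ![s 2 0, s 2 1]] := by
      ext i j
      fin_cases i <;> fin_cases j <;> rfl
    rw [hs]
    exact h _ _ _ _ _ _

/-! ### Inner products of the GHZ vectors. -/

/-- Twice the inner products of the vectors `xyVec`, as Gaussian integers `a + b i`. -/
def xyGram (l l' : Label) : GaussianInt :=
  if l.1 = l'.1 then if l.2 = l'.2 then ⟨2, 0⟩ else 0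
  else if l.1 = 0 then if l.2 = l'.2 then ⟨1, -1⟩ else ⟨1, 1⟩
  else if l.2 = l'.2 then ⟨1, 1⟩ else ⟨1, -1⟩

theorem inner_xyVec (l l' : Label) :
    ip (xyVec l) (xyVec l') = (xyGram l l').toComplex / 2 := by
  have h := rt_mul_rt
  have hI := Complex.I_mul_I
  obtain ⟨x, a⟩ := l
  obtain ⟨y, b⟩ := l'
  fin_cases x <;> fin_cases y <;> fin_cases a <;> fin_cases b <;>
    simp [-inner_self_eq_norm_sq_to_K, xyVec, PiLp.inner_apply, Fin.sum_univ_two, star_rt,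
      GaussianInt.toComplex_def, xyGram] <;> grind

/-- Each party contributes a Gaussian integer over 2. On the sixteen events the product of the three
is `8`, `4` or `0`: the phases cancel, and the claim becomes a finite check in exact arithmetic. -/
theorem inner_refVec_some (i j : Fin 16) :
    ip (refVec (some i)) (refVec (some j)) =
      if i = j then 1 else if Compatible i j then 1 / 2 else 0 := by
  have h (i j : Fin 16) : xyGram (merminEvent i).1 (merminEvent j).1 *
      (xyGram (merminEvent i).2.1 (merminEvent j).2.1 *
        xyGram (merminEvent i).2.2 (merminEvent j).2.2) =
      if i = j then 8 else if Compatible i j then 4 else 0 := by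
    revert i j; decide +kernel
  have h1 := congrArg GaussianInt.toComplex (h i j)
  rw [map_mul, map_mul] at h1
  rw [refVec, refVec, inner_tmul3, inner_xyVec, inner_xyVec, inner_xyVec]
  split_ifs at h1 ⊢ <;> simp only [map_ofNat, map_zero] at h1 <;> linear_combination h1 / 8

theorem inner_ket_left (i : Fin 2) (x : Qubit) : ip (ket i) x = x i := by
  simp [ket, EuclideanSpace.inner_single_left]

theorem inner_ghzState_refVec (i : Fin 16) : ip ghzState (refVec (some i)) = 1 / 2 := by
  have h := rt_mul_rt
  have hI := Complex.I_mul_I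
  simp only [ghzState, refVec, ip, inner_smul_left, inner_add_left]
  rw [← ip, ← ip, inner_tmul3, inner_tmul3, star_rt]
  simp only [inner_ket_left]
  fin_cases i <;> simp [merminEvent, xyVec] <;> grind

theorem inner_refVec_ghzState (i : Fin 16) : ip (refVec (some i)) ghzState = 1 / 2 := by
  rw [ip, ← inner_conj_symm, ← ip, inner_ghzState_refVec, map_div₀,
    map_one, Complex.conj_ofNat]

theorem inner_ghzState : ip ghzState ghzState = 1 := by
  rw [ip, inner_self_eq_norm_sq_to_K, norm_ghzState]; simp

theorem merminPrimal_eq_inner_refVec (i j : Option (Fin 16)) :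
    merminPrimal ℂ i j = refEta i * refEta j * ip (refVec j) (refVec i) := by
  cases i <;> cases j
  · simp only [merminPrimal, refEta, refVec, inner_ghzState]; norm_num
  · rw [refVec, inner_refVec_ghzState]; simp only [merminPrimal, refEta]; norm_num
  · rw [refVec, inner_ghzState_refVec]; simp only [merminPrimal, refEta]; norm_num
  · rename_i i j
    have hc : Compatible j i ↔ Compatible i j := ⟨Compatible.symm, Compatible.symm⟩
    rw [merminPrimal_some_some, inner_refVec_some, refEta, refEta]
    simp only [eq_comm (a := j), hc]
    split_ifs <;> norm_num

theorem eventProj_ofVectors_apply {v : Label → Qubit}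
    (hv : ∀ x, Orthonormal ℂ fun a : Fin 2 => v (x, a)) (e : Event)
    (ψ : Tensor3 Qubit Qubit Qubit) :
    map3 ((BinaryMeasurements.ofVectors v hv).proj e.1)
      ((BinaryMeasurements.ofVectors v hv).proj e.2.1)
      ((BinaryMeasurements.ofVectors v hv).proj e.2.2) ψ =
    ip (tmul3 (v e.1) (v e.2.1) (v e.2.2)) ψ • tmul3 (v e.1) (v e.2.1) (v e.2.2) := by
  induction ψ using Tensor3.induction_on with
  | hclosed => exact isClosed_eq (by fun_prop) (by fun_prop)
  | htmul a b c =>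
    rw [map3_tmul3, inner_tmul3]
    simp only [BinaryMeasurements.ofVectors, InnerProductSpace.rankOne_apply, tmul3_smul_left,
      tmul3_smul_mid, tmul3_smul_right, smul_smul]
    congr 1
    unfold ip
    ring
  | hadd x y hx hy => rw [map_add, hx, hy, ip, ip, ip, inner_add_right, add_smul]

theorem ghzReference_eventProj (i : Fin 16) :
    ghzReference.eventProj (merminEvent i) ghzReference.state =
      refEta (some i) • refVec (some i) := by
  rw [← show ip (refVec (some i)) ghzState = refEta (some i) from inner_refVec_ghzState i]
  exact eventProj_ofVectors_apply orthonormal_xyVec _ _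

/-! ### The reference matrix is positive semidefinite -/

theorem merminPrimal_eq_inner (i j : Option (Fin 16)) :
    merminPrimal ℂ i j = ip (refEta i • refVec i) (refEta j • refVec j) := by
  have h1 : (starRingEnd ℂ) (refEta i) = refEta i := by
    cases i <;> simp [refEta, Complex.conj_ofNat]
  have h2 : merminPrimal ℂ i j = merminPrimal ℂ j i := by
    cases i <;> cases j <;> try rfl
    rename_i i j
    have hc : Compatible j i ↔ Compatible i j := ⟨Compatible.symm, Compatible.symm⟩
    simp only [merminPrimal_some_some, hc, eq_comm (a := j)]
  rw [h2, merminPrimal_eq_inner_refVec]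
  unfold ip
  rw [inner_smul_left, inner_smul_right, h1]
  ring

theorem posSemidef_merminPrimal_complex : (merminPrimal ℂ).PosSemidef := by
  have h : merminPrimal ℂ = Matrix.gram ℂ fun i => refEta i • refVec i := by
    ext i j
    rw [merminPrimal_eq_inner, Matrix.gram_apply]
  rw [h]
  exact Matrix.posSemidef_gram ℂ _

theorem merminPrimal_real_eq_re (i j : Option (Fin 16)) :
    merminPrimal ℝ i j = (merminPrimal ℂ i j).re := by
  cases i <;> cases j
  · simp [merminPrimal]
  · simp [merminPrimal]
  · simp [merminPrimal]
  · simp only [merminPrimal_some_some]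
    split_ifs <;> simp

theorem posSemidef_merminPrimal_real : (merminPrimal ℝ).PosSemidef := by
  -- The real matrix is the Gram matrix of the same vectors for the real part of the inner product.
  let _ : InnerProductSpace ℝ (Tensor3 Qubit Qubit Qubit) :=
    InnerProductSpace.rclikeToReal ℂ (Tensor3 Qubit Qubit Qubit)
  have h : merminPrimal ℝ = Matrix.gram ℝ fun i => refEta i • refVec i := by
    ext i j
    rw [merminPrimal_real_eq_re, merminPrimal_eq_inner, Matrix.gram_apply]
    rfl
  rw [h]
  exact Matrix.posSemidef_gram ℝ _

theorem ghzReference_momentMatrix : ghzReference.momentMatrix = merminPrimal ℂ := by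
  have hstate : ghzReference.state = ghzState := rfl
  have hproj (i : Option (Fin 16)) :
      ghzReference.extProj i ghzReference.state = refEta i • refVec i := by
    cases i
    · simp [Realization.extProj, refEta, refVec, hstate]
    · exact ghzReference_eventProj _
  ext i j
  rw [merminPrimal_eq_inner_refVec, Realization.momentMatrix, Matrix.of_apply, hproj, map_smul]
  cases j
  · simp [Realization.extProj, refEta, hstate, refVec, inner_smul_right]
  · rename_i j
    have h : ghzReference.extProj (some j) (refVec i) =
        ip (refVec (some j)) (refVec i) • refVec (some j) :=
      eventProj_ofVectors_apply orthonormal_xyVec _ _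
    rw [h, hstate, ip, inner_smul_right, inner_smul_right, ← ip, inner_ghzState_refVec]
    simp only [refEta]
    ring

/-! ### The measured observables -/

theorem obs_ofVectors_xyVec_zero :
    (BinaryMeasurements.ofVectors xyVec orthonormal_xyVec).obs 0 =
      Matrix.toEuclideanCLM (n := Fin 2) (𝕜 := ℂ) (-pauliX) := by
  have h := rt_mul_rt
  ext x i
  fin_cases i <;>
    simp [BinaryMeasurements.obs, BinaryMeasurements.ofVectors, xyVec, pauliX, PiLp.inner_apply,
      Fin.sum_univ_two, star_rt, Matrix.mulVec, dotProduct] <;> grind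

theorem obs_ofVectors_xyVec_one :
    (BinaryMeasurements.ofVectors xyVec orthonormal_xyVec).obs 1 =
      Matrix.toEuclideanCLM (n := Fin 2) (𝕜 := ℂ) pauliY := by
  have h := rt_mul_rt
  have hI := Complex.I_mul_I
  ext x i
  fin_cases i <;>
    simp [BinaryMeasurements.obs, BinaryMeasurements.ofVectors, xyVec, pauliY, PiLp.inner_apply,
      Fin.sum_univ_two, star_rt, Matrix.mulVec, dotProduct] <;> grind

theorem obs_ofVectors_zxVec_zero :
    (BinaryMeasurements.ofVectors zxVec orthonormal_zxVec).obs 0 =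
      Matrix.toEuclideanCLM (n := Fin 2) (𝕜 := ℂ) pauliZ := by
  ext x i
  fin_cases i <;>
    simp [BinaryMeasurements.obs, BinaryMeasurements.ofVectors, zxVec, pauliZ, PiLp.inner_apply,
      Fin.sum_univ_two, Matrix.mulVec, dotProduct]

theorem obs_ofVectors_zxVec_one :
    (BinaryMeasurements.ofVectors zxVec orthonormal_zxVec).obs 1 =
      Matrix.toEuclideanCLM (n := Fin 2) (𝕜 := ℂ) pauliX := by
  have h := rt_mul_rt
  ext x i
  fin_cases i <;>
    simp [BinaryMeasurements.obs, BinaryMeasurements.ofVectors, zxVec, pauliX, PiLp.inner_apply,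
      Fin.sum_univ_two, star_rt, Matrix.mulVec, dotProduct] <;> grind

/-! ### The local unitary between the two reference realizations -/

/-- The orthonormal basis of a qubit given by two orthonormal vectors. -/
noncomputable def qubitBasis (v : Fin 2 → Qubit) (hv : Orthonormal ℂ v) :
    OrthonormalBasis (Fin 2) ℂ Qubit :=
  (basisOfOrthonormalOfCardEqFinrank hv (by simp)).toOrthonormalBasis (by simpa using hv)

theorem qubitBasis_apply (v : Fin 2 → Qubit) (hv : Orthonormal ℂ v) (i : Fin 2) :
    qubitBasis v hv i = v i := by
  simp [qubitBasis]

/-- The phases relating the images of the vectors `xyVec` to the vectors `zxVec`. -/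
noncomputable def refPhase (l : Label) : ℂ :=
  ![![-Complex.I, -1], ![-((1 + Complex.I) * rt), (1 - Complex.I) * rt]] l.1 l.2

theorem refPhase_mul_conj (l : Label) : refPhase l * (starRingEnd ℂ) (refPhase l) = 1 := by
  have h := rt_mul_rt
  have hI := Complex.I_mul_I
  obtain ⟨x, a⟩ := l
  fin_cases x <;> fin_cases a <;> simp [refPhase, star_rt] <;> grind

theorem orthonormal_refPhase_smul : Orthonormal ℂ fun a : Fin 2 => refPhase (0, a) • zxVec (0, a) := by
  have h := orthonormal_iff_ite.1 (orthonormal_zxVec 0)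
  rw [orthonormal_iff_ite]
  intro i j
  rw [inner_smul_left, inner_smul_right, h]
  split_ifs with hij
  · rw [hij, mul_one, mul_comm, refPhase_mul_conj]
  · simp

/-- The local unitary carrying the GHZ realization to the `σ_z`, `σ_x` realization. -/
noncomputable def refUnitary : Qubit ≃ₗᵢ[ℂ] Qubit :=
  (qubitBasis _ (orthonormal_xyVec 0)).equiv (qubitBasis _ orthonormal_refPhase_smul)
    (Equiv.refl _)

theorem refUnitary_xyVec (l : Label) : refUnitary (xyVec l) = refPhase l • zxVec l := by
  have h0 (a : Fin 2) : refUnitary (xyVec (0, a)) = refPhase (0, a) • zxVec (0, a) := by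
    have := OrthonormalBasis.equiv_apply_basis (qubitBasis _ (orthonormal_xyVec 0))
      (qubitBasis _ orthonormal_refPhase_smul) (Equiv.refl _) a
    rwa [Equiv.refl_apply, qubitBasis_apply, qubitBasis_apply] at this
  have h := rt_mul_rt
  have hI := Complex.I_mul_I
  -- The images of the setting-`0` vectors force those of setting `1`. The ratio `i` of the phases
  -- `-i` and `-1` makes the latter multiples of the `σ_x` eigenvectors; the common phase is chosen
  -- so that the states match exactly.
  have hP : xyVec (1, 0) = ((1 - Complex.I) / 2) • xyVec (0, 0) +
      ((1 + Complex.I) / 2) • xyVec (0, 1) := by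
    ext i; fin_cases i <;> simp [xyVec] <;> grind
  have hM : xyVec (1, 1) = ((1 + Complex.I) / 2) • xyVec (0, 0) +
      ((1 - Complex.I) / 2) • xyVec (0, 1) := by
    ext i; fin_cases i <;> simp [xyVec] <;> grind
  obtain ⟨x, a⟩ := l
  fin_cases x
  · exact h0 a
  · fin_cases a
    · simp only [Fin.mk_one, Fin.zero_eta, Fin.isValue]
      rw [hP, map_add, map_smul, map_smul, h0, h0]
      ext i; fin_cases i <;> simp [zxVec, refPhase] <;> grind
    · simp only [Fin.mk_one, Fin.isValue]
      rw [hM, map_add, map_smul, map_smul, h0, h0]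
      ext i; fin_cases i <;> simp [zxVec, refPhase] <;> grind

theorem refUnitary_proj (l : Label) (x : Qubit) :
    refUnitary ((BinaryMeasurements.ofVectors xyVec orthonormal_xyVec).proj l x) =
      (BinaryMeasurements.ofVectors zxVec orthonormal_zxVec).proj l (refUnitary x) := by
  have h1 : ip (xyVec l) x = (starRingEnd ℂ) (refPhase l) * ip (zxVec l) (refUnitary x) := by
    rw [ip, ← refUnitary.inner_map_map, refUnitary_xyVec, inner_smul_left]
  simp only [BinaryMeasurements.ofVectors, InnerProductSpace.rankOne_apply, map_smul,
    refUnitary_xyVec, smul_smul]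
  rw [← ip, h1]
  congr 1
  linear_combination ip (zxVec l) (refUnitary x) * refPhase_mul_conj l

theorem refUnitary_ket_zero :
    refUnitary (ket 0) = (-(Complex.I * rt)) • ket 0 + (-rt) • ket 1 := by
  have h := rt_mul_rt
  have : ket 0 = rt • xyVec lZ + rt • xyVec lO := by
    ext i; fin_cases i <;> simp [xyVec, ket] <;> grind
  rw [this, map_add, map_smul, map_smul, refUnitary_xyVec, refUnitary_xyVec]
  ext i
  fin_cases i <;> simp [xyVec, zxVec, refPhase, ket] <;> grind

theorem refUnitary_ket_one :
    refUnitary (ket 1) = (Complex.I * rt) • ket 0 + (-rt) • ket 1 := by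
  have h := rt_mul_rt
  have : ket 1 = (-rt) • xyVec lZ + rt • xyVec lO := by
    ext i; fin_cases i <;> simp [xyVec, ket] <;> grind
  rw [this, map_add, map_smul, map_smul, refUnitary_xyVec, refUnitary_xyVec]
  ext i
  fin_cases i <;> simp [xyVec, zxVec, refPhase, ket] <;> grind

theorem map3_refUnitary_ghzState :
    map3 (refUnitary : Qubit →L[ℂ] Qubit) (refUnitary : Qubit →L[ℂ] Qubit)
      (refUnitary : Qubit →L[ℂ] Qubit) ghzState = zxState := by
  have h := rt_mul_rt
  have hI := Complex.I_mul_I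
  have hc (x : Qubit) : (refUnitary : Qubit →L[ℂ] Qubit) x = refUnitary x := rfl
  simp only [ghzState, zxState, map_smul, map_add, map3_tmul3, hc, refUnitary_ket_zero,
    refUnitary_ket_one, tmul3_add_left, tmul3_add_mid, tmul3_add_right, tmul3_smul_left,
    tmul3_smul_mid, tmul3_smul_right]
  match_scalars <;> grind

/-! ### Linear dependencies between the product vectors -/

/-- Twice the Gram matrix of the seventeen reference vectors. -/
def refGram : Option (Fin 16) → Option (Fin 16) → ℤ
  | none, none => 2
  | none, some _ => 1
  | some _, none => 1
  | some i, some j => if i = j then 2 else if Compatible i j then 1 else 0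

theorem inner_refVec (a b : Option (Fin 16)) :
    ip (refVec a) (refVec b) = (refGram a b : ℂ) / 2 := by
  cases a <;> cases b
  · rw [refVec, inner_ghzState, refGram]; norm_num
  · rw [refVec, inner_ghzState_refVec, refGram]; norm_num
  · rw [refVec, inner_refVec_ghzState, refGram]; norm_num
  · rw [inner_refVec_some, refGram]
    split_ifs <;> norm_num

/-- Indices of seven linearly independent reference vectors. -/
def refBasis : Fin 7 → Option (Fin 16) := ![none, some 0, some 1, some 2, some 4, some 8, some 15]

/-- Twice the inverse of the submatrix of `refGram` on the indices `refBasis`. -/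
def refGramInv : Fin 7 → Fin 7 → ℤ :=
  ![![4, -2, -2, -2, 0, 0, 0], ![-2, 3, 1, 1, -1, -1, 1], ![-2, 1, 3, 1, -1, 1, -1],
    ![-2, 1, 1, 3, 1, -1, -1], ![0, -1, -1, 1, 3, -1, -1], ![0, -1, 1, -1, -1, 3, -1],
    ![0, 1, -1, -1, -1, -1, 3]]

/-- The coordinates of the reference vectors in the basis `refBasis`, doubled. -/
def refCoord (a : Option (Fin 16)) (k : Fin 7) : ℤ :=
  ∑ l, refGramInv k l * refGram (refBasis l) a

theorem refGramInv_mul (k l : Fin 7) :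
    ∑ m, refGramInv k m * refGram (refBasis m) (refBasis l) = if k = l then 2 else 0 := by
  revert k l; decide +kernel

/-- The rank is seven because the product vectors have Gram matrix `I + E/2` and `E` has eigenvalues
`6, 2, -2` with multiplicities `1, 6, 9`; the GHZ vector lies in their span. The proof inverts a `7
× 7` Gram submatrix explicitly. -/
theorem linearIndependent_refVec_refBasis : LinearIndependent ℂ fun k => refVec (refBasis k) := by
  rw [Fintype.linearIndependent_iff]
  intro g hg k
  have h1 (m : Fin 7) : ∑ l, (refGram (refBasis m) (refBasis l) : ℂ) * g l = 0 := by
    have h := congrArg (fun z => ip (refVec (refBasis m)) z) hg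
    simp only [ip, inner_sum, inner_smul_right, inner_zero_right] at h
    have h' : ∑ l, (refGram (refBasis m) (refBasis l) : ℂ) * g l =
        2 * ∑ l, g l * ip (refVec (refBasis m)) (refVec (refBasis l)) := by
      rw [Finset.mul_sum]
      refine Finset.sum_congr rfl fun l _ => ?_
      rw [inner_refVec]; ring
    rw [h']
    exact mul_eq_zero_of_right _ h
  have h2 : ∑ l, ((∑ m, refGramInv k m * refGram (refBasis m) (refBasis l) : ℤ) : ℂ) * g l =
      ∑ m, (refGramInv k m : ℂ) * ∑ l, (refGram (refBasis m) (refBasis l) : ℂ) * g l := by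
    simp only [Int.cast_sum, Int.cast_mul, Finset.sum_mul, Finset.mul_sum]
    rw [Finset.sum_comm]
    exact Finset.sum_congr rfl fun _ _ => Finset.sum_congr rfl fun _ _ => mul_assoc _ _ _
  simp only [h1, mul_zero, Finset.sum_const_zero, refGramInv_mul, Int.cast_ite, ite_mul,
    Int.cast_zero, zero_mul, Finset.sum_ite_eq, Finset.mem_univ, if_true] at h2
  simpa using h2

theorem two_smul_refVec (a : Option (Fin 16)) :
    (2 : ℂ) • refVec a = ∑ k, (refCoord a k : ℂ) • refVec (refBasis k) := by
  -- Twice the squared norm of the difference of the two sides, as an integer expression in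
  -- `refGram`; its vanishing proves the linear relation.
  have hq : ∀ a, 4 * refGram a a - 4 * ∑ k, refCoord a k * refGram (refBasis k) a +
      ∑ k, ∑ l, refCoord a k * refCoord a l * refGram (refBasis k) (refBasis l) = 0 := by
    decide +kernel
  have hsymm : ∀ a b, refGram a b = refGram b a := by decide +kernel
  rw [← sub_eq_zero, ← inner_self_eq_zero (𝕜 := ℂ)]
  have h := congrArg (fun n : ℤ => (n : ℂ)) (hq a)
  simp only [inner_sub_left, inner_sub_right, inner_smul_left, inner_smul_right, inner_sum,
    sum_inner, map_intCast, map_ofNat]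
  simp only [inner_refVec, hsymm a]
  push_cast at h
  have e1 : ∑ k, (refCoord a k : ℂ) * ((refGram (refBasis k) a : ℂ) / 2) =
      (∑ k, (refCoord a k : ℂ) * (refGram (refBasis k) a : ℂ)) / 2 := by
    rw [Finset.sum_div]
    exact Finset.sum_congr rfl fun k _ => by ring
  have e2 : ∑ k, (refCoord a k : ℂ) * (2 * ((refGram (refBasis k) a : ℂ) / 2) -
      ∑ l, (refCoord a l : ℂ) * ((refGram (refBasis l) (refBasis k) : ℂ) / 2)) =
      ∑ k, (refCoord a k : ℂ) * (refGram (refBasis k) a : ℂ) -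
      (∑ k, ∑ l, (refCoord a k : ℂ) * (refCoord a l : ℂ) *
        (refGram (refBasis k) (refBasis l) : ℂ)) / 2 := by
    rw [Finset.sum_div, ← Finset.sum_sub_distrib]
    refine Finset.sum_congr rfl fun k _ => ?_
    rw [mul_sub, Finset.mul_sum, Finset.sum_div]
    congr 1
    · ring
    · exact Finset.sum_congr rfl fun l _ => by rw [hsymm (refBasis l)]; ring
  rw [e1, e2]
  linear_combination h / 2

theorem finrank_span_refVec :
    Module.finrank ℂ (Submodule.span ℂ (Set.range refVec)) = 7 := by
  have h : Submodule.span ℂ (Set.range refVec) =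
      Submodule.span ℂ (Set.range fun k => refVec (refBasis k)) := by
    refine le_antisymm (Submodule.span_le.2 ?_) (Submodule.span_mono ?_)
    · rintro _ ⟨a, rfl⟩
      have : refVec a = (1 / 2 : ℂ) • ∑ k, (refCoord a k : ℂ) • refVec (refBasis k) := by
        rw [← two_smul_refVec, smul_smul]; norm_num
      rw [this]
      exact Submodule.smul_mem _ _ (Submodule.sum_mem _ fun k _ =>
        Submodule.smul_mem _ _ (Submodule.subset_span ⟨k, rfl⟩))
    · rintro _ ⟨k, rfl⟩
      exact ⟨_, rfl⟩
  rw [h, finrank_span_eq_card linearIndependent_refVec_refBasis, Fintype.card_fin]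

/-- Two orthonormal pairs whose mutual inner products are all `1/2` span a three-dimensional
space. -/
theorem finrank_span_two_pairs {E : Type*} [NormedAddCommGroup E] [InnerProductSpace ℂ E]
    {p q r s : E} (hpp : ip p p = 1) (hqq : ip q q = 1) (hrr : ip r r = 1) (hss : ip s s = 1)
    (hpq : ip p q = 0) (hrs : ip r s = 0) (hpr : ip p r = 1 / 2) (hps : ip p s = 1 / 2)
    (hqr : ip q r = 1 / 2) (hqs : ip q s = 1 / 2) :
    Module.finrank ℂ (Submodule.span ℂ ({p, q, r, s} : Set E)) = 3 := by
  have flip {x y : E} {c : ℝ} (h : ip x y = c) : ip y x = c := by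
    rw [ip, ← inner_conj_symm, ← ip, h, Complex.conj_ofReal]
  have hqp : ip q p = 0 := by simpa using flip (c := 0) (by simpa using hpq)
  have hsr : ip s r = 0 := by simpa using flip (c := 0) (by simpa using hrs)
  have half {x y : E} (h : ip x y = 1 / 2) : ip y x = 1 / 2 := by
    simpa using flip (c := 1 / 2) (by simpa using h)
  have hrp := half hpr
  have hsp := half hps
  have hrq := half hqr
  have hsq := half hqs
  -- The squared norm is `2 + 2 - 2·(4·½) = 0`.
  have hrel : p + q - (r + s) = 0 := by
    rw [← inner_self_eq_zero (𝕜 := ℂ)]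
    simp only [inner_sub_left, inner_sub_right, inner_add_left, inner_add_right]
    simp only [hpp, hqq, hrr, hss, hpq, hqp, hrs, hsr, hpr, hrp, hps, hsp, hqr, hrq, hqs, hsq]
    norm_num
  have hs : s = p + q - r := by
    rw [sub_eq_zero] at hrel
    rw [hrel]; abel
  have hli : LinearIndependent ℂ ![p, q, r] := by
    rw [Fintype.linearIndependent_iff]
    intro g hg
    simp only [Fin.sum_univ_three, Matrix.cons_val_zero, Matrix.cons_val_one, Matrix.cons_val] at hg
    have h1 := congrArg (fun z => ip p z) hg
    have h2 := congrArg (fun z => ip q z) hg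
    have h3 := congrArg (fun z => ip r z) hg
    simp only [ip, inner_add_right, inner_smul_right, inner_zero_right] at h1 h2 h3
    simp only [hpp, hpq, hpr, hqp, hqq, hqr, hrp, hrq, hrr] at h1 h2 h3
    intro i
    fin_cases i <;> simp <;> grind
  have hspan : Submodule.span ℂ ({p, q, r, s} : Set E) =
      Submodule.span ℂ (Set.range ![p, q, r]) := by
    refine le_antisymm (Submodule.span_le.2 ?_) (Submodule.span_mono ?_)
    · have hp : p ∈ Submodule.span ℂ (Set.range ![p, q, r]) := Submodule.subset_span ⟨0, rfl⟩
      have hq : q ∈ Submodule.span ℂ (Set.range ![p, q, r]) := Submodule.subset_span ⟨1, rfl⟩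
      have hr : r ∈ Submodule.span ℂ (Set.range ![p, q, r]) := Submodule.subset_span ⟨2, rfl⟩
      rintro x (rfl | rfl | rfl | rfl)
      · exact hp
      · exact hq
      · exact hr
      · rw [hs]
        exact sub_mem (add_mem hp hq) hr
    · rintro _ ⟨i, rfl⟩
      fin_cases i <;> simp
  rw [hspan, finrank_span_eq_card hli, Fintype.card_fin]

theorem inner_tmul_xyVec (p q : Label × Label) :
    ip (xyVec p.1 ⊗ₜ[ℂ] xyVec p.2) (xyVec q.1 ⊗ₜ[ℂ] xyVec q.2) =
      (xyGram p.1 q.1 * xyGram p.2 q.2).toComplex / 4 := by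
  rw [ip, TensorProduct.inner_tmul, ← ip, ← ip, inner_xyVec, inner_xyVec, map_mul]
  ring

instance (x : Label) (p : Label × Label) : Decidable (p ∈ pairsBC x) :=
  inferInstanceAs (Decidable (∃ i, merminEvent i = (x, p)))

/-- The two pairs of orthogonal product vectors for a label of the first party. -/
def orthogonalPairs (x : Label) : Fin 4 → Label × Label :=
  ![![![(lP, lP), (lM, lM), (lZ, lO), (lO, lZ)], ![(lO, lO), (lZ, lZ), (lM, lP), (lP, lM)]],
    ![![(lZ, lP), (lO, lM), (lP, lZ), (lM, lO)], ![(lO, lP), (lZ, lM), (lP, lO), (lM, lZ)]]]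
    x.1 x.2

theorem mem_pairsBC_iff (x : Label) (p : Label × Label) : p ∈ pairsBC x ↔
    p = orthogonalPairs x 0 ∨ p = orthogonalPairs x 1 ∨ p = orthogonalPairs x 2 ∨
      p = orthogonalPairs x 3 := by
  revert x p; decide +kernel

theorem pairsBC_eq (x : Label) : pairsBC x =
    {orthogonalPairs x 0, orthogonalPairs x 1, orthogonalPairs x 2, orthogonalPairs x 3} :=
  Set.ext fun p => mem_pairsBC_iff x p

theorem xyGram_orthogonalPairs (x : Label) (m n : Fin 4) :
    xyGram (orthogonalPairs x m).1 (orthogonalPairs x n).1 *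
      xyGram (orthogonalPairs x m).2 (orthogonalPairs x n).2 =
    if m = n then 4 else if (m = 0 ∧ n = 1) ∨ (m = 1 ∧ n = 0) ∨ (m = 2 ∧ n = 3) ∨ (m = 3 ∧ n = 2)
      then 0 else 2 := by
  revert x m n; decide +kernel

theorem finrank_span_pairsBC (x : Label) : Module.finrank ℂ (Submodule.span ℂ
    ((fun p : Label × Label => xyVec p.1 ⊗ₜ[ℂ] xyVec p.2) '' pairsBC x)) = 3 := by
  rw [pairsBC_eq, Set.image_insert_eq, Set.image_insert_eq, Set.image_insert_eq,
    Set.image_singleton]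
  refine finrank_span_two_pairs ?_ ?_ ?_ ?_ ?_ ?_ ?_ ?_ ?_ ?_ <;>
    rw [inner_tmul_xyVec, xyGram_orthogonalPairs]
  · rw [if_pos rfl, map_ofNat]; norm_num
  · rw [if_pos rfl, map_ofNat]; norm_num
  · rw [if_pos rfl, map_ofNat]; norm_num
  · rw [if_pos rfl, map_ofNat]; norm_num
  · rw [if_neg (by decide), if_pos (by decide), map_zero, zero_div]
  · rw [if_neg (by decide), if_pos (by decide), map_zero, zero_div]
  · rw [if_neg (by decide), if_neg (by decide), map_ofNat]; norm_num
  · rw [if_neg (by decide), if_neg (by decide), map_ofNat]; norm_num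
  · rw [if_neg (by decide), if_neg (by decide), map_ofNat]; norm_num
  · rw [if_neg (by decide), if_neg (by decide), map_ofNat]; norm_num

/-! ### Spanning and connectivity conditions on labels. -/

theorem span_xyVec_pair {l l' : Label} (hne : l ≠ l') :
    Submodule.span ℂ (xyVec '' {l, l'}) = ⊤ := by
  -- With diagonal entries `2`, the doubled Gram matrix has determinant `4` or `2`, never zero.
  have hgram : ∀ l l' : Label, l ≠ l' → (xyGram l l' * xyGram l' l = 0 ∨
      xyGram l l' * xyGram l' l = 2) ∧ xyGram l l = 2 := by decide +kernel
  have hli : LinearIndependent ℂ ![xyVec l, xyVec l'] := by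
    rw [Fintype.linearIndependent_iff]
    intro g hg
    simp only [Fin.sum_univ_two, Matrix.cons_val_zero, Matrix.cons_val_one] at hg
    have h1 := congrArg (fun z => ip (xyVec l) z) hg
    have h2 := congrArg (fun z => ip (xyVec l') z) hg
    simp only [ip, inner_add_right, inner_smul_right, inner_zero_right] at h1 h2
    simp only [inner_xyVec, (hgram l l' hne).2, (hgram l' l hne.symm).2] at h1 h2
    have h3 : (xyGram l l').toComplex * (xyGram l' l).toComplex = 0 ∨
        (xyGram l l').toComplex * (xyGram l' l).toComplex = 2 := by
      rcases (hgram l l' hne).1 with h | h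
      · left; rw [← map_mul, h, map_zero]
      · right; rw [← map_mul, h, map_ofNat]
    rw [map_ofNat] at h1 h2
    intro i
    fin_cases i <;> simp <;> rcases h3 with h3 | h3 <;> grind
  have h := hli.span_eq_top_of_card_eq_finrank (by simp)
  rw [← h]
  congr 1
  ext x
  simp [Set.image_insert_eq, or_comm]

theorem connected_of_pair {α : Type*} [DecidableEq α] {x y : α}
    {G : SimpleGraph ({x, y} : Finset α)} (h : G.Adj ⟨x, by simp⟩ ⟨y, by simp⟩) :
    G.Connected := by
  have : Nonempty ({x, y} : Finset α) := ⟨⟨x, by simp⟩⟩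
  refine ⟨?_⟩
  have hx (z : ({x, y} : Finset α)) : G.Reachable ⟨x, by simp⟩ z := by
    obtain ⟨z, hz⟩ := z
    rcases Finset.mem_insert.1 hz with rfl | hz'
    · exact SimpleGraph.Reachable.refl _
    · obtain rfl := Finset.mem_singleton.1 hz'
      exact h.reachable
  exact fun a b => (hx a).symm.trans (hx b)

theorem inner_refVec_ne_zero {i j : Fin 16} (h : Compatible i j) :
    ip (refVec (some i)) (refVec (some j)) ≠ 0 := by
  rw [inner_refVec_some, if_neg h.1, if_pos h]
  norm_num

instance (t : Fin 3) (e f : Event) : Decidable (SharesOnly t e f) := by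
  unfold SharesOnly; infer_instance

theorem connectedLabels_O_P : ConnectedLabels lO lP := by
  -- The events `OMP`, `PZP`, `PMO`: the pairs share the third, second and first component
  -- respectively.
  refine ⟨by decide, 1, 4, 11, ⟨by decide, by decide, by decide,
    inner_refVec_ne_zero (by decide +kernel), inner_refVec_ne_zero (by decide +kernel),
    inner_refVec_ne_zero (by decide +kernel), 2, 1, 0, by decide, by decide, by decide,
    by decide +kernel, by decide +kernel, by decide +kernel⟩, ?_⟩
  simp [merminEvent]

theorem connected_graphA_O_P : (graphA {lO, lP}).Connected := by
  refine connected_of_pair ?_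
  rw [graphA, SimpleGraph.fromRel_adj]
  exact ⟨by simp, Or.inl connectedLabels_O_P⟩

theorem inner_xyVec_ne_zero {l l' : Label} (h : l.1 ≠ l'.1) : ip (xyVec l) (xyVec l') ≠ 0 := by
  have h0 : ∀ l l' : Label, l.1 ≠ l'.1 → xyGram l l' ≠ 0 := by decide +kernel
  rw [inner_xyVec]
  exact div_ne_zero (fun h' => h0 l l' h (GaussianInt.toComplex_eq_zero.1 h')) two_ne_zero

theorem exists_inner_xyVec_eq_zero (l : Label) : ∃ l', ip (xyVec l) (xyVec l') = 0 := by
  have h : ∀ l : Label, ∃ l', xyGram l l' = 0 := by decide +kernel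
  obtain ⟨l', hl'⟩ := h l
  exact ⟨l', by rw [inner_xyVec, hl']; simp⟩

theorem bipartiteCondition_O_P : BipartiteCondition (pairsBC lO ∪ pairsBC lP) := by
  -- The pairs `OO`, `MP` come from `pairsBC lO` and `OM`, `MO` from `pairsBC lP`; the two sets of
  -- third labels meet in `O`.
  refine ⟨{lO, lM}, fun y => if y = lO then {lO, lM} else {lP, lO}, ?_, ?_, ?_, ?_, ?_, ?_⟩
  · simp
  · intro y hy
    dsimp only
    split_ifs <;> simp
  · simp only [Set.mem_union]
    decide +kernel
  · rw [Finset.coe_pair]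
    exact span_xyVec_pair (by decide)
  · intro y hy
    dsimp only
    split_ifs
    · rw [Finset.coe_pair]
      exact span_xyVec_pair (by decide)
    · rw [Finset.coe_pair]
      exact span_xyVec_pair (by decide)
  · refine connected_of_pair ?_
    rw [graphB, SimpleGraph.fromRel_adj]
    exact ⟨by simp, Or.inl ⟨inner_xyVec_ne_zero (by decide), by decide⟩⟩

theorem pairsBC_O : pairsBC lO = {(lO, lO), (lZ, lZ), (lM, lP), (lP, lM)} := pairsBC_eq lO

theorem pairsBC_P : pairsBC lP = {(lZ, lP), (lP, lZ), (lO, lM), (lM, lO)} := by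
  ext p
  simp only [Set.mem_insert_iff, Set.mem_singleton_iff]
  revert p
  decide +kernel

/-! ### Observables of a single party. -/

section Party

variable {H : Type*} [NormedAddCommGroup H] [InnerProductSpace ℂ H] [CompleteSpace H]
  (M : BinaryMeasurements H)

theorem BinaryMeasurements.proj_one (x : Fin 2) : M.proj (x, 1) = 1 - M.proj (x, 0) :=
  eq_sub_of_add_eq' (M.complete x)

theorem BinaryMeasurements.proj_mul_proj_of_ne {x : Fin 2} {a b : Fin 2} (hab : a ≠ b) :
    M.proj (x, a) * M.proj (x, b) = 0 := by
  have h := (M.isStarProjection (x, 0)).isIdempotentElem.eq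
  fin_cases a <;> fin_cases b <;> simp [M.proj_one, mul_sub, sub_mul, h] at hab ⊢

theorem BinaryMeasurements.obs_eq (x : Fin 2) : M.obs x = 2 * M.proj (x, 0) - 1 := by
  rw [BinaryMeasurements.obs, M.proj_one, two_mul]
  abel

theorem BinaryMeasurements.obs_mul_self (x : Fin 2) : M.obs x * M.obs x = 1 := by
  have h := (M.isStarProjection (x, 0)).isIdempotentElem.eq
  rw [M.obs_eq]
  simp only [two_mul, mul_sub, sub_mul, mul_add, add_mul, h, mul_one, one_mul]
  abel

theorem BinaryMeasurements.obs_apply_obs (x : Fin 2) (v : H) : M.obs x (M.obs x v) = v :=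
  congrArg (fun T : H →L[ℂ] H => T v) (M.obs_mul_self x)

theorem BinaryMeasurements.isSelfAdjoint_obs (x : Fin 2) : IsSelfAdjoint (M.obs x) :=
  (M.isStarProjection (x, 0)).isSelfAdjoint.sub (M.isStarProjection (x, 1)).isSelfAdjoint

theorem BinaryMeasurements.inner_obs (x : Fin 2) (v w : H) :
    ip (M.obs x v) w = ip v (M.obs x w) :=
  (ContinuousLinearMap.isSelfAdjoint_iff_isSymmetric.mp (M.isSelfAdjoint_obs x)) v w

theorem BinaryMeasurements.proj_zero_eq (x : Fin 2) :
    M.proj (x, 0) = (1 / 2 : ℂ) • (1 + M.obs x) := by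
  rw [BinaryMeasurements.obs, M.proj_one]
  module

theorem BinaryMeasurements.proj_one_eq (x : Fin 2) :
    M.proj (x, 1) = (1 / 2 : ℂ) • (1 - M.obs x) := by
  rw [BinaryMeasurements.obs, M.proj_one]
  module

end Party

/-! ### Moment matrices and the quantum bound. -/

section Realization

variable {HA HB HC : Type*}
  [NormedAddCommGroup HA] [InnerProductSpace ℂ HA] [CompleteSpace HA]
  [NormedAddCommGroup HB] [InnerProductSpace ℂ HB] [CompleteSpace HB]
  [NormedAddCommGroup HC] [InnerProductSpace ℂ HC] [CompleteSpace HC]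
  (R : Realization HA HB HC)

theorem Realization.inner_state : ip R.state R.state = 1 := by
  rw [ip, inner_self_eq_norm_sq_to_K, R.norm_state]; simp

theorem Realization.sum_prob (x y z : Fin 2) :
    ∑ a, ∑ b, ∑ c, R.prob ((x, a), (y, b), (z, c)) = 1 := by
  have h : map3 (R.A.proj (x, 0) + R.A.proj (x, 1)) (R.B.proj (y, 0) + R.B.proj (y, 1))
      (R.C.proj (z, 0) + R.C.proj (z, 1)) R.state = R.state := by
    rw [R.A.complete, R.B.complete, R.C.complete, map3_one]; rfl
  have h2 := congrArg Complex.re R.inner_state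
  rw [← h] at h2
  nth_rewrite 1 [h] at h2
  simp only [map3_add_left, map3_add_mid, map3_add_right, add_apply,
    ip, inner_add_right, Complex.add_re, Complex.one_re] at h2
  simp only [Fin.sum_univ_two, Realization.prob, Realization.eventProj]
  linarith

/-- The product of outcomes is `+1` exactly on the four outcome triples with an even number of `-1`;
normalization eliminates the other four. -/
theorem Realization.correlator_eq (x y z : Fin 2) :
    R.correlator x y z = 2 * (R.prob ((x, 0), (y, 0), (z, 0)) + R.prob ((x, 0), (y, 1), (z, 1)) +
      R.prob ((x, 1), (y, 0), (z, 1)) + R.prob ((x, 1), (y, 1), (z, 0))) - 1 := by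
  have h := R.sum_prob x y z
  simp only [Fin.sum_univ_two, Realization.prob, Realization.eventProj] at h
  simp only [Realization.correlator, BinaryMeasurements.obs, map3_sub_left, map3_sub_mid,
    map3_sub_right, sub_apply, ip, inner_sub_right, Complex.sub_re,
    Realization.prob, Realization.eventProj] at h ⊢
  linarith

theorem Realization.merminExpectation_eq : R.merminExpectation = 2 * R.merminValue - 4 := by
  -- The last four Mermin events have an odd number of `-1` outcomes, while
  -- `Realization.correlator_eq` counts the even ones; normalization for `ZZZ` exchanges them.
  have h := R.sum_prob 0 0 0
  simp only [Fin.sum_univ_two] at h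
  simp only [Realization.merminExpectation, Realization.merminValue, R.correlator_eq]
  have hsum (f : Fin 16 → ℝ) : ∑ i, f i = f 0 + f 1 + f 2 + f 3 + f 4 + f 5 + f 6 + f 7 + f 8 +
      f 9 + f 10 + f 11 + f 12 + f 13 + f 14 + f 15 := by
    simp only [Fin.sum_univ_succ, Fin.sum_univ_zero]
    simp only [add_zero, ← add_assoc]
    rfl
  rw [hsum]
  simp only [merminEvent, Matrix.cons_val]
  linarith

theorem Realization.star_eventProj (e : Event) : star (R.eventProj e) = R.eventProj e := by
  rw [Realization.eventProj, star_map3, (R.A.isStarProjection _).isSelfAdjoint.star_eq,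
    (R.B.isStarProjection _).isSelfAdjoint.star_eq, (R.C.isStarProjection _).isSelfAdjoint.star_eq]

theorem Realization.eventProj_mul_self (e : Event) :
    R.eventProj e * R.eventProj e = R.eventProj e := by
  rw [Realization.eventProj, map3_mul, (R.A.isStarProjection _).isIdempotentElem.eq,
    (R.B.isStarProjection _).isIdempotentElem.eq, (R.C.isStarProjection _).isIdempotentElem.eq]

theorem Realization.eventProj_mul_of_exclusive {e f : Event} (h : Exclusive e f) :
    R.eventProj e * R.eventProj f = 0 := by
  obtain ⟨⟨x, a⟩, ⟨y, b⟩, ⟨z, c⟩⟩ := e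
  obtain ⟨⟨x', a'⟩, ⟨y', b'⟩, ⟨z', c'⟩⟩ := f
  rw [Realization.eventProj, Realization.eventProj, map3_mul]
  rcases h with ⟨h1, h2⟩ | ⟨h1, h2⟩ | ⟨h1, h2⟩ <;> dsimp only at h1 h2 ⊢ <;> subst h1
  · rw [R.A.proj_mul_proj_of_ne h2, map3_zero_left]
  · rw [R.B.proj_mul_proj_of_ne h2, map3_zero_mid]
  · rw [R.C.proj_mul_proj_of_ne h2, map3_zero_right]

theorem Realization.star_extProj (i : Option (Fin 16)) : star (R.extProj i) = R.extProj i := by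
  cases i
  · exact star_one _
  · exact R.star_eventProj _

theorem Realization.momentMatrix_apply (i j : Option (Fin 16)) :
    R.momentMatrix i j = ip (R.extProj j R.state) (R.extProj i R.state) := by
  rw [Realization.momentMatrix, Matrix.of_apply]
  nth_rewrite 1 [← R.star_extProj j]
  exact ContinuousLinearMap.adjoint_inner_right _ _ _

/-- The matrix is a transposed Gram matrix, hence positive. Idempotence of the event projectors
gives the diagonal condition, and projectors of exclusive events have product zero. -/
theorem Realization.thetaFeasible_momentMatrix :
    ThetaFeasible ℂ merminGraph R.momentMatrix := by
  refine ⟨?_, ?_, fun i => ?_, fun i j hij => ?_⟩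
  · have h : R.momentMatrix = (Matrix.gram ℂ fun i => R.extProj i R.state).transpose := by
      ext i j
      rw [R.momentMatrix_apply, Matrix.transpose_apply, Matrix.gram_apply]
    rw [h]
    exact (Matrix.posSemidef_gram ℂ _).transpose
  · exact R.inner_state
  · rw [Realization.momentMatrix, Matrix.of_apply, Matrix.of_apply]
    exact congrArg (fun T : Tensor3 HA HB HC →L[ℂ] Tensor3 HA HB HC => ip R.state (T R.state))
      (R.eventProj_mul_self (merminEvent i))
  · have h := R.eventProj_mul_of_exclusive (Exclusive.symm (merminGraph_adj.1 hij).2)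
    have h2 := congrArg
      (fun T : Tensor3 HA HB HC →L[ℂ] Tensor3 HA HB HC => ip R.state (T R.state)) h
    exact h2.trans (by simp)

theorem Realization.thetaObjective_momentMatrix :
    thetaObjective ℂ 1 R.momentMatrix = R.merminValue := by
  rw [thetaObjective_one, map_sum]
  refine Finset.sum_congr rfl fun i _ => ?_
  rw [R.thetaFeasible_momentMatrix.2.2.1 i, Realization.momentMatrix, Matrix.of_apply]
  rfl

theorem Realization.merminValue_le : R.merminValue ≤ 4 :=
  R.thetaObjective_momentMatrix ▸ R.thetaFeasible_momentMatrix.objective_le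

theorem Realization.merminValue_eq_four_iff :
    R.merminValue = 4 ↔ IsThetaOptimal ℂ merminGraph 1 R.momentMatrix := by
  rw [isThetaOptimal_iff_objective posSemidef_merminPrimal_complex R.thetaFeasible_momentMatrix,
    R.thetaObjective_momentMatrix]

theorem ghzReference_merminValue : ghzReference.merminValue = 4 := by
  rw [← ghzReference.thetaObjective_momentMatrix, ghzReference_momentMatrix,
    thetaObjective_merminPrimal]

theorem isGreatest_quantumValues : IsGreatest quantumValues 4 := by
  constructor
  · exact ⟨Qubit, Qubit, Qubit, inferInstance, inferInstance, inferInstance, inferInstance,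
      inferInstance, inferInstance, inferInstance, inferInstance, inferInstance, ghzReference,
      ghzReference_merminValue⟩
  · rintro s ⟨HA, HB, HC, _, _, _, _, _, _, _, _, _, R, rfl⟩
    exact R.merminValue_le

/-! ### Stabilizer equations at the maximum -/

/-- Equality in Cauchy–Schwarz: `‖y - x‖² = 1 - 2 + 1`. -/
theorem eq_of_re_inner_eq_one {E : Type*} [NormedAddCommGroup E] [InnerProductSpace ℂ E] {x y : E}
    (hx : ‖x‖ = 1) (hy : ‖y‖ = 1) (h : (ip x y).re = 1) : y = x := by
  have h1 := @norm_sub_sq ℂ E _ _ _ y x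
  rw [← inner_conj_symm, RCLike.conj_re, hx, hy] at h1
  have h2 : RCLike.re (inner ℂ x y) = 1 := h
  rw [h2] at h1
  have : ‖y - x‖ ^ 2 = 0 := by rw [h1]; norm_num
  exact sub_eq_zero.1 (norm_eq_zero.1 (by simpa using this))

theorem Realization.norm_correlation (x y z : Fin 2) :
    ‖map3 (R.A.obs x) (R.B.obs y) (R.C.obs z) R.state‖ = 1 := by
  have h : ip (map3 (R.A.obs x) (R.B.obs y) (R.C.obs z) R.state)
      (map3 (R.A.obs x) (R.B.obs y) (R.C.obs z) R.state) = 1 := by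
    rw [inner_map3_of_adjoint (R.A.inner_obs x) (R.B.inner_obs y) (R.C.inner_obs z), map3_map3]
    have h1 := R.A.obs_mul_self x
    have h2 := R.B.obs_mul_self y
    have h3 := R.C.obs_mul_self z
    rw [ContinuousLinearMap.mul_def] at h1 h2 h3
    rw [h1, h2, h3, map3_one]
    exact R.inner_state
  have h1 := inner_self_eq_norm_sq (𝕜 := ℂ) (map3 (R.A.obs x) (R.B.obs y) (R.C.obs z) R.state)
  rw [← ip, h] at h1
  have h2 : ‖map3 (R.A.obs x) (R.B.obs y) (R.C.obs z) R.state‖ ^ 2 = 1 := by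
    rw [← h1]; simp
  nlinarith [norm_nonneg (map3 (R.A.obs x) (R.B.obs y) (R.C.obs z) R.state)]

theorem Realization.abs_correlator_le (x y z : Fin 2) : |R.correlator x y z| ≤ 1 := by
  refine (Complex.abs_re_le_norm _).trans ((norm_inner_le_norm _ _).trans ?_)
  rw [R.norm_state, R.norm_correlation, one_mul]

/-- The Mermin expectation equals `4` and is a signed sum of four correlators bounded by `1`, so
each is extremal; the products of observables preserve the norm of the state, so Cauchy–Schwarz is
sharp. -/
theorem Realization.stabilizers (h : R.merminValue = 4) :
    map3 (R.A.obs 0) (R.B.obs 1) (R.C.obs 1) R.state = R.state ∧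
    map3 (R.A.obs 1) (R.B.obs 0) (R.C.obs 1) R.state = R.state ∧
    map3 (R.A.obs 1) (R.B.obs 1) (R.C.obs 0) R.state = R.state ∧
    map3 (R.A.obs 0) (R.B.obs 0) (R.C.obs 0) R.state = -R.state := by
  have hE := R.merminExpectation_eq
  rw [h, Realization.merminExpectation] at hE
  have h1 := abs_le.1 (R.abs_correlator_le 0 1 1)
  have h2 := abs_le.1 (R.abs_correlator_le 1 0 1)
  have h3 := abs_le.1 (R.abs_correlator_le 1 1 0)
  have h4 := abs_le.1 (R.abs_correlator_le 0 0 0)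
  have hpos {x y z : Fin 2} (hc : R.correlator x y z = 1) :
      map3 (R.A.obs x) (R.B.obs y) (R.C.obs z) R.state = R.state :=
    eq_of_re_inner_eq_one R.norm_state (R.norm_correlation x y z) hc
  refine ⟨hpos (by linarith), hpos (by linarith), hpos (by linarith), ?_⟩
  rw [eq_neg_iff_add_eq_zero, ← neg_eq_iff_add_eq_zero]
  refine (eq_of_re_inner_eq_one R.norm_state (y := -_)
    (by rw [norm_neg, R.norm_correlation 0 0 0]) ?_)
  have hc : R.correlator 0 0 0 = -1 := by linarith
  rw [ip, inner_neg_right, Complex.neg_re]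
  exact neg_eq_iff_eq_neg.2 hc

end Realization

/-! ### The qubit hidden in the kernel of an anticommutator. -/

section Frame

variable {H : Type*} [NormedAddCommGroup H] [InnerProductSpace ℂ H] [CompleteSpace H]
  (M : BinaryMeasurements H)

/-- The anticommutator of the two observables. -/
def BinaryMeasurements.anticomm : H →L[ℂ] H := M.obs 0 * M.obs 1 + M.obs 1 * M.obs 0

/-- The vectors fixed by the observable `Z` and killed by the anticommutator. -/
def BinaryMeasurements.frame : Submodule ℂ H :=
  (M.obs 0 - 1).ker ⊓ M.anticomm.ker

/-- Closedness makes the frame a Hilbert space, so the embeddings have adjoints and it can serve as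
the auxiliary space of the self-test. -/
instance : CompleteSpace M.frame :=
  IsClosed.completeSpace_coe (hs := (ContinuousLinearMap.isClosed_ker (M.obs 0 - 1)).inter
    (ContinuousLinearMap.isClosed_ker M.anticomm))

theorem BinaryMeasurements.mem_frame {v : H} : v ∈ M.frame ↔
    M.obs 0 v = v ∧ M.obs 0 (M.obs 1 v) + M.obs 1 (M.obs 0 v) = 0 := by
  rw [BinaryMeasurements.frame, Submodule.mem_inf, LinearMap.mem_ker, LinearMap.mem_ker,
    ← sub_eq_zero (b := v)]
  rfl

/-- The two embeddings of the frame: the inclusion, and the inclusion followed by the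
observable `X`. -/
noncomputable def BinaryMeasurements.emb (i : Fin 2) : M.frame →L[ℂ] H :=
  ![M.frame.subtypeL, (M.obs 1).comp M.frame.subtypeL] i

theorem BinaryMeasurements.emb_zero_apply (k : M.frame) : M.emb 0 k = k := rfl

theorem BinaryMeasurements.emb_one_apply (k : M.frame) : M.emb 1 k = M.obs 1 k := rfl

theorem BinaryMeasurements.obs_zero_emb (i : Fin 2) (k : M.frame) :
    M.obs 0 (M.emb i k) = (![1, -1] i : ℂ) • M.emb i k := by
  obtain ⟨h1, h2⟩ := M.mem_frame.1 k.2
  rw [h1] at h2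
  fin_cases i
  · simpa [M.emb_zero_apply] using h1
  · simpa [M.emb_one_apply] using eq_neg_of_add_eq_zero_left h2

theorem BinaryMeasurements.obs_one_emb (i : Fin 2) (k : M.frame) :
    M.obs 1 (M.emb i k) = M.emb (1 - i) k := by
  fin_cases i
  · rfl
  · exact M.obs_apply_obs 1 _

/-- The two embeddings land in the eigenspaces `+1` and `-1` of `Z`, hence are orthogonal; each is
isometric because `X` is unitary. -/
theorem BinaryMeasurements.inner_emb (i j : Fin 2) (k l : M.frame) :
    ip (M.emb i k) (M.emb j l) = if i = j then ip k l else 0 := by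
  have hzero : ip (M.emb 0 k) (M.emb 1 l) = 0 ∧ ip (M.emb 1 k) (M.emb 0 l) = 0 := by
    have h1 := M.inner_obs 0 (M.emb 0 k) (M.emb 1 l)
    have h2 := M.inner_obs 0 (M.emb 1 k) (M.emb 0 l)
    rw [M.obs_zero_emb, M.obs_zero_emb] at h1 h2
    simp only [Matrix.cons_val_zero, Matrix.cons_val_one, one_smul, neg_smul, inner_neg_left,
      inner_neg_right, ip] at h1 h2 ⊢
    exact ⟨by linear_combination h1 / 2, by linear_combination -h2 / 2⟩
  fin_cases i <;> fin_cases j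
  · rfl
  · exact hzero.1
  · exact hzero.2
  · change ip (M.obs 1 (k : H)) (M.obs 1 (l : H)) = ip (k : H) (l : H)
    rw [M.inner_obs, M.obs_apply_obs]

theorem BinaryMeasurements.adjoint_emb_emb (i j : Fin 2) (k : M.frame) :
    (M.emb i).adjoint (M.emb j k) = if i = j then k else 0 := by
  refine ext_inner_left ℂ fun l => ?_
  rw [ContinuousLinearMap.adjoint_inner_right]
  refine (M.inner_emb i j l k).trans ?_
  split_ifs <;> simp

theorem BinaryMeasurements.adjoint_emb_obs_zero (i : Fin 2) :
    (M.emb i).adjoint.comp (M.obs 0) = (![1, -1] i : ℂ) • (M.emb i).adjoint := by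
  ext1 v
  refine ext_inner_left ℂ fun l => ?_
  rw [ContinuousLinearMap.comp_apply, ContinuousLinearMap.adjoint_inner_right,
    smul_apply, inner_smul_right, ContinuousLinearMap.adjoint_inner_right]
  refine (M.inner_obs 0 _ _).symm.trans ?_
  rw [M.obs_zero_emb, ip, inner_smul_left]
  congr 1
  fin_cases i <;> simp

theorem BinaryMeasurements.adjoint_emb_obs_one (i : Fin 2) :
    (M.emb i).adjoint.comp (M.obs 1) = (M.emb (1 - i)).adjoint := by
  ext1 v
  refine ext_inner_left ℂ fun l => ?_
  rw [ContinuousLinearMap.comp_apply, ContinuousLinearMap.adjoint_inner_right,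
    ContinuousLinearMap.adjoint_inner_right]
  refine (M.inner_obs 1 _ _).symm.trans ?_
  rw [M.obs_one_emb]

/-- The projection onto the sum of the ranges of the two embeddings. -/
noncomputable def BinaryMeasurements.frameProj : H →L[ℂ] H :=
  ∑ i, (M.emb i).comp (M.emb i).adjoint

theorem BinaryMeasurements.isSelfAdjoint_frameProj : IsSelfAdjoint M.frameProj := by
  rw [BinaryMeasurements.frameProj]
  refine isSelfAdjoint_sum _ fun i _ => ?_
  rw [ContinuousLinearMap.isSelfAdjoint_iff', ContinuousLinearMap.adjoint_comp,
    ContinuousLinearMap.adjoint_adjoint]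

theorem BinaryMeasurements.frameProj_emb (i : Fin 2) (k : M.frame) :
    M.frameProj (M.emb i k) = M.emb i k := by
  rw [BinaryMeasurements.frameProj, Fin.sum_univ_two]
  simp only [add_apply, ContinuousLinearMap.comp_apply, M.adjoint_emb_emb]
  fin_cases i <;> simp

/-- Split `v` by the eigenvalue of `Z`: the part `(v + Z v)/2` lies in the frame, and the part `(v -
Z v)/2` is `X` applied to the frame vector `X (v - Z v)/2`. -/
theorem BinaryMeasurements.frameProj_of_anticomm {v : H} (hv : M.anticomm v = 0) :
    M.frameProj v = v := by
  have hv' : M.obs 0 (M.obs 1 v) + M.obs 1 (M.obs 0 v) = 0 := hv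
  have h0 (w : H) := M.obs_apply_obs 0 w
  have hZ := congrArg (M.obs 0) hv'
  rw [map_add, map_zero, h0] at hZ
  have hX := congrArg (M.obs 1) hv'
  rw [map_add, map_zero, M.obs_apply_obs 1] at hX
  have hp : (1 / 2 : ℂ) • (v + M.obs 0 v) ∈ M.frame := by
    rw [M.mem_frame]
    simp only [map_smul, map_add, h0]
    refine ⟨by module, ?_⟩
    have : (1 / 2 : ℂ) • ((M.obs 0 (M.obs 1 v) + M.obs 1 (M.obs 0 v)) +
      (M.obs 1 v + M.obs 0 (M.obs 1 (M.obs 0 v)))) = 0 := by rw [hv', hZ]; simp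
    rw [← this]
    module
  have hm : (1 / 2 : ℂ) • (M.obs 1 v - M.obs 1 (M.obs 0 v)) ∈ M.frame := by
    rw [M.mem_frame]
    simp only [map_smul, map_sub, M.obs_apply_obs 1]
    have e1 : M.obs 0 (M.obs 1 v) = -M.obs 1 (M.obs 0 v) := eq_neg_of_add_eq_zero_left hv'
    have e2 : M.obs 0 (M.obs 1 (M.obs 0 v)) = -M.obs 1 v := eq_neg_of_add_eq_zero_right hZ
    rw [e1, e2, map_neg, M.obs_apply_obs 1, h0]
    simp only [map_neg, M.obs_apply_obs 1]
    constructor <;> module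
  have hsum : v = M.emb 0 ⟨_, hp⟩ + M.emb 1 ⟨_, hm⟩ := by
    rw [M.emb_zero_apply, M.emb_one_apply]
    simp only [map_smul, map_sub, M.obs_apply_obs 1]
    module
  rw [hsum, map_add, M.frameProj_emb, M.frameProj_emb]

/-- The linear map sending `a ⊗ k` to `a₀ J₀ k + a₁ J₁ k` for the two embeddings `J₀, J₁`. -/
noncomputable def BinaryMeasurements.frameMap : Qubit ⊗[ℂ] M.frame →ₗ[ℂ] H :=
  TensorProduct.lift (∑ i, LinearMap.smulRight
    (S := ℂ) (EuclideanSpace.proj i : Qubit →L[ℂ] ℂ).toLinearMap (M.emb i).toLinearMap)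

theorem BinaryMeasurements.frameMap_tmul (a : Qubit) (k : M.frame) :
    M.frameMap (a ⊗ₜ k) = a 0 • M.emb 0 k + a 1 • M.emb 1 k := by
  simp [BinaryMeasurements.frameMap, Fin.sum_univ_two]

theorem BinaryMeasurements.inner_frameMap (x y : Qubit ⊗[ℂ] M.frame) :
    ip (M.frameMap x) (M.frameMap y) = ip x y := by
  induction x with
  | zero => rw [map_zero]; exact (inner_zero_left _).trans (inner_zero_left (𝕜 := ℂ) y).symm
  | add x x' hx hx' =>
    rw [map_add]
    exact (inner_add_left _ _ _).trans
      ((congrArg₂ (· + ·) hx hx').trans (inner_add_left _ _ _).symm)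
  | tmul a k =>
    induction y with
    | zero => rw [map_zero]; exact (inner_zero_right _).trans (inner_zero_right (𝕜 := ℂ) (a ⊗ₜ[ℂ] k)).symm
    | add y y' hy hy' =>
      rw [map_add]
      exact (inner_add_right _ _ _).trans
        ((congrArg₂ (· + ·) hy hy').trans (inner_add_right _ _ _).symm)
    | tmul b l =>
      have h (i j : Fin 2) := M.inner_emb i j k l
      unfold ip at h ⊢
      rw [TensorProduct.inner_tmul, M.frameMap_tmul, M.frameMap_tmul]
      simp only [inner_add_left, inner_add_right, inner_smul_left, inner_smul_right, h,
        PiLp.inner_apply, Fin.sum_univ_two]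
      simp
      ring

/-- The local isometry onto the sum of the ranges of the two embeddings. -/
noncomputable def BinaryMeasurements.frameIsometry : Qubit ⊗[ℂ] M.frame →ₗᵢ[ℂ] H :=
  ⟨M.frameMap, fun x => by
    rw [@norm_eq_sqrt_re_inner ℂ, @norm_eq_sqrt_re_inner ℂ]
    exact congrArg (fun z => √(RCLike.re z)) (M.inner_frameMap x x)⟩

theorem BinaryMeasurements.frameIsometry_tmul (a : Qubit) (k : M.frame) :
    M.frameIsometry (a ⊗ₜ k) = a 0 • M.emb 0 k + a 1 • M.emb 1 k := M.frameMap_tmul a k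

theorem BinaryMeasurements.frameIsometry_comp_mkL (i : Fin 2) :
    M.frameIsometry.toContinuousLinearMap.comp (TensorProduct.mkL ℂ Qubit M.frame (ket i)) =
      M.emb i := by
  ext1 k
  refine (M.frameIsometry_tmul (ket i) k).trans ?_
  fin_cases i <;> simp [ket]

/-- On the two embedded copies `Z` acts by `1` and `-1`, and `X` exchanges them. -/
theorem BinaryMeasurements.obs_frameIsometry (x : Fin 2) (a : Qubit) (k : M.frame) :
    M.obs x (M.frameIsometry (a ⊗ₜ k)) = M.frameIsometry
      ((BinaryMeasurements.ofVectors zxVec orthonormal_zxVec).obs x a ⊗ₜ k) := by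
  fin_cases x
  · simp only [Fin.zero_eta]
    rw [obs_ofVectors_zxVec_zero]
    simp only [M.frameIsometry_tmul, map_add, map_smul, M.obs_zero_emb]
    simp [pauliZ, Matrix.mulVec, dotProduct]
  · simp only [Fin.mk_one]
    rw [obs_ofVectors_zxVec_one]
    simp only [M.frameIsometry_tmul, map_add, map_smul, M.obs_one_emb]
    simp [pauliX, Matrix.mulVec, dotProduct]
    abel

theorem BinaryMeasurements.proj_frameIsometry (l : Label) (a : Qubit) (k : M.frame) :
    M.proj l (M.frameIsometry (a ⊗ₜ k)) = M.frameIsometry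
      ((BinaryMeasurements.ofVectors zxVec orthonormal_zxVec).proj l a ⊗ₜ k) := by
  obtain ⟨x, b⟩ := l
  have h := M.obs_frameIsometry x a k
  fin_cases b
  · simp only [Fin.zero_eta]
    rw [M.proj_zero_eq, BinaryMeasurements.proj_zero_eq]
    simp only [smul_apply, add_apply, one_apply_eq_self, ← TensorProduct.smul_tmul',
      TensorProduct.add_tmul, map_smul, map_add, h]
  · simp only [Fin.mk_one]
    rw [M.proj_one_eq, BinaryMeasurements.proj_one_eq]
    simp only [smul_apply, sub_apply, one_apply_eq_self, ← TensorProduct.smul_tmul',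
      TensorProduct.sub_tmul, map_smul, h]
    rw [M.frameIsometry.map_sub]

end Frame

/-! ### Self-testing of the two reference realizations. -/

section SelfTest

variable {HA : Type u} {HB : Type v} {HC : Type w}
  [NormedAddCommGroup HA] [InnerProductSpace ℂ HA] [CompleteSpace HA]
  [NormedAddCommGroup HB] [InnerProductSpace ℂ HB] [CompleteSpace HB]
  [NormedAddCommGroup HC] [InnerProductSpace ℂ HC] [CompleteSpace HC]
  (R : Realization HA HB HC)

/-- Multiplying the stabilizer equations in pairs cancels squares of observables. On the state, `ZX`
of the first party acts as `ZX` of the second, while `XZ` of the first acts as minus that operator,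
the sign coming from `ZZZ`. The other parties follow cyclically. -/
theorem Realization.anticomm_state (h : R.merminValue = 4) :
    map3 R.A.anticomm (1 : HB →L[ℂ] HB) (1 : HC →L[ℂ] HC) R.state = 0 ∧
    map3 (1 : HA →L[ℂ] HA) R.B.anticomm (1 : HC →L[ℂ] HC) R.state = 0 ∧
    map3 (1 : HA →L[ℂ] HA) (1 : HB →L[ℂ] HB) R.C.anticomm R.state = 0 := by
  obtain ⟨h1, h2, h3, h4⟩ := R.stabilizers h
  have hA := R.A.obs_mul_self
  have hB := R.B.obs_mul_self
  have hC := R.C.obs_mul_self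
  have mm (S S' : HA →L[ℂ] HA) (T T' : HB →L[ℂ] HB) (U U' : HC →L[ℂ] HC) :
      map3 S T U (map3 S' T' U' R.state) = map3 (S * S') (T * T') (U * U') R.state :=
    map3_map3 _ _ _ _ _ _ _
  have step {S : HA →L[ℂ] HA} {T : HB →L[ℂ] HB} {U : HC →L[ℂ] HC} {x y z : Fin 2}
      (hs : map3 (R.A.obs x) (R.B.obs y) (R.C.obs z) R.state = R.state) :
      map3 S T U R.state = map3 (S * R.A.obs x) (T * R.B.obs y) (U * R.C.obs z) R.state := by
    rw [← mm, hs]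
  have step' {S : HA →L[ℂ] HA} {T : HB →L[ℂ] HB} {U : HC →L[ℂ] HC} :
      map3 S T U R.state =
        -map3 (S * R.A.obs 0) (T * R.B.obs 0) (U * R.C.obs 0) R.state := by
    rw [← mm, h4, map_neg, neg_neg]
  refine ⟨?_, ?_, ?_⟩
  · have e1 : map3 (R.A.obs 0 * R.A.obs 1) (1 : HB →L[ℂ] HB) (1 : HC →L[ℂ] HC) R.state =
        map3 (1 : HA →L[ℂ] HA) (R.B.obs 0 * R.B.obs 1) (1 : HC →L[ℂ] HC) R.state := by
      rw [step h2, step h1]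
      simp only [mul_assoc, hA, hC, one_mul, mul_one]
    have e2 : map3 (R.A.obs 1 * R.A.obs 0) (1 : HB →L[ℂ] HB) (1 : HC →L[ℂ] HC) R.state =
        -map3 (1 : HA →L[ℂ] HA) (R.B.obs 0 * R.B.obs 1) (1 : HC →L[ℂ] HC) R.state := by
      rw [step', step h3]
      simp only [mul_assoc, hA, hC, one_mul, mul_one]
    rw [BinaryMeasurements.anticomm, map3_add_left, add_apply, e1, e2, add_neg_cancel]
  · have e1 : map3 (1 : HA →L[ℂ] HA) (R.B.obs 0 * R.B.obs 1) (1 : HC →L[ℂ] HC) R.state =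
        map3 (1 : HA →L[ℂ] HA) (1 : HB →L[ℂ] HB) (R.C.obs 0 * R.C.obs 1) R.state := by
      rw [step h3, step h2]
      simp only [mul_assoc, hA, hB, one_mul, mul_one]
    have e2 : map3 (1 : HA →L[ℂ] HA) (R.B.obs 1 * R.B.obs 0) (1 : HC →L[ℂ] HC) R.state =
        -map3 (1 : HA →L[ℂ] HA) (1 : HB →L[ℂ] HB) (R.C.obs 0 * R.C.obs 1) R.state := by
      rw [step', step h1]
      simp only [mul_assoc, hA, hB, one_mul, mul_one]
    rw [BinaryMeasurements.anticomm, map3_add_mid, add_apply, e1, e2, add_neg_cancel]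
  · have e1 : map3 (1 : HA →L[ℂ] HA) (1 : HB →L[ℂ] HB) (R.C.obs 0 * R.C.obs 1) R.state =
        map3 (R.A.obs 0 * R.A.obs 1) (1 : HB →L[ℂ] HB) (1 : HC →L[ℂ] HC) R.state := by
      rw [step h1, step h3]
      simp only [mul_assoc, hB, hC, one_mul, mul_one]
    have e2 : map3 (1 : HA →L[ℂ] HA) (1 : HB →L[ℂ] HB) (R.C.obs 1 * R.C.obs 0) R.state =
        -map3 (R.A.obs 0 * R.A.obs 1) (1 : HB →L[ℂ] HB) (1 : HC →L[ℂ] HC) R.state := by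
      rw [step', step h2]
      simp only [mul_assoc, hB, hC, one_mul, mul_one]
    rw [BinaryMeasurements.anticomm, map3_add_right, add_apply, e1, e2, add_neg_cancel]

/-- The frame projection fixes the kernel of the anticommutator, so it fixes the state one party at
a time. -/
theorem Realization.frameProj_state (h : R.merminValue = 4) :
    map3 R.A.frameProj R.B.frameProj R.C.frameProj R.state = R.state := by
  obtain ⟨hA, hB, hC⟩ := R.anticomm_state h
  have eA := map3_left_eq_self R.A.isSelfAdjoint_frameProj
    (fun _ hx => R.A.frameProj_of_anticomm hx) hA
  have eB := map3_mid_eq_self R.B.isSelfAdjoint_frameProj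
    (fun _ hx => R.B.frameProj_of_anticomm hx) hB
  have eC := map3_right_eq_self R.C.isSelfAdjoint_frameProj
    (fun _ hx => R.C.frameProj_of_anticomm hx) hC
  have hprod : map3 R.A.frameProj R.B.frameProj R.C.frameProj = map3 R.A.frameProj 1 1 *
      (map3 1 R.B.frameProj 1 * map3 1 1 R.C.frameProj) := by
    rw [map3_mul, map3_mul]; simp
  rw [hprod]
  change map3 R.A.frameProj 1 1 (map3 1 R.B.frameProj 1 (map3 1 1 R.C.frameProj R.state)) = _
  rw [eC, eB, eA]

/-- The component of the state along a triple of embeddings. -/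
noncomputable def Realization.comp (i j k : Fin 2) : Tensor3 R.A.frame R.B.frame R.C.frame :=
  map3 (R.A.emb i).adjoint (R.B.emb j).adjoint (R.C.emb k).adjoint R.state

theorem Realization.state_eq_sum (h : R.merminValue = 4) :
    R.state = ∑ i, ∑ j, ∑ k, map3 (R.A.emb i) (R.B.emb j) (R.C.emb k) (R.comp i j k) := by
  conv_lhs => rw [← R.frameProj_state h]
  simp only [BinaryMeasurements.frameProj, Fin.sum_univ_two, map3_add_left, map3_add_mid,
    map3_add_right, add_apply, Realization.comp, map3_map3]
  abel

/-- The four stabilizer equations read on components: `Z` contributes a sign and `X` flips an index.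
-/
theorem Realization.comp_eq (h : R.merminValue = 4) (i j k : Fin 2) :
    R.comp i j k = (![1, -1] i : ℂ) • R.comp i (1 - j) (1 - k) ∧
    R.comp i j k = (![1, -1] j : ℂ) • R.comp (1 - i) j (1 - k) ∧
    R.comp i j k = (![1, -1] k : ℂ) • R.comp (1 - i) (1 - j) k ∧
    R.comp i j k = -((![1, -1] i * ![1, -1] j * ![1, -1] k : ℂ) • R.comp i j k) := by
  obtain ⟨h1, h2, h3, h4⟩ := R.stabilizers h
  refine ⟨?_, ?_, ?_, ?_⟩
  · conv_lhs => rw [Realization.comp, ← h1, map3_map3]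
    rw [R.A.adjoint_emb_obs_zero, R.B.adjoint_emb_obs_one, R.C.adjoint_emb_obs_one,
      map3_smul_left]
    rfl
  · conv_lhs => rw [Realization.comp, ← h2, map3_map3]
    rw [R.A.adjoint_emb_obs_one, R.B.adjoint_emb_obs_zero, R.C.adjoint_emb_obs_one,
      map3_smul_mid]
    rfl
  · conv_lhs => rw [Realization.comp, ← h3, map3_map3]
    rw [R.A.adjoint_emb_obs_one, R.B.adjoint_emb_obs_one, R.C.adjoint_emb_obs_zero,
      map3_smul_right]
    rfl
  · conv_lhs => rw [Realization.comp, ← neg_neg R.state, ← h4, map_neg, map3_map3]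
    rw [R.A.adjoint_emb_obs_zero, R.B.adjoint_emb_obs_zero, R.C.adjoint_emb_obs_zero,
      map3_smul_left, map3_smul_mid, map3_smul_right, smul_smul, smul_smul]
    rfl

/-- The junk state left over by the local isometries. -/
noncomputable def Realization.junk : Tensor3 R.A.frame R.B.frame R.C.frame :=
  (2 : ℂ) • R.comp 0 0 1

theorem inner_ket_zxState (i j k : Fin 2) : ip (tmul3 (ket i) (ket j) (ket k)) zxState =
    ![![![0, 1 / 2], ![1 / 2, 0]], ![![1 / 2, 0], ![0, -1 / 2]]] i j k := by
  simp only [zxState, ip, inner_smul_right, inner_add_right, inner_sub_right]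
  simp only [inner_tmul3, inner_ket]
  fin_cases i <;> fin_cases j <;> fin_cases k <;> norm_num

/-- The `ZZZ` equation kills the components with an even number of indices `1`; the other three
equations relate the remaining four to `R.comp 0 0 1`, with a minus sign at `111`. The factor `2` in
`Realization.junk` offsets the amplitudes `±1/2` of `zxState`. -/
theorem Realization.comp_eq_smul_junk (h : R.merminValue = 4) (i j k : Fin 2) :
    R.comp i j k = ip (tmul3 (ket i) (ket j) (ket k)) zxState • R.junk := by
  have hzero {x : Tensor3 R.A.frame R.B.frame R.C.frame} (hx : x = -x) : x = 0 := by
    have : (2 : ℂ) • x = 0 := by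
      rw [two_smul]
      nth_rewrite 1 [hx]
      exact neg_add_cancel x
    exact (smul_eq_zero.1 this).resolve_left two_ne_zero
  have h000 := (R.comp_eq h 0 0 0).2.2.2
  have h011 := (R.comp_eq h 0 1 1).2.2.2
  have h101 := (R.comp_eq h 1 0 1).2.2.2
  have h110 := (R.comp_eq h 1 1 0).2.2.2
  have h010 := (R.comp_eq h 0 1 0).1
  have h100 := (R.comp_eq h 1 0 0).2.1
  have h111 := (R.comp_eq h 1 1 1).2.2.1
  rw [inner_ket_zxState, Realization.junk, smul_smul]
  simp at h000 h011 h101 h110 h010 h100 h111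
  fin_cases i <;> fin_cases j <;> fin_cases k
  · simpa using hzero h000
  · simp
  · simpa using h010
  · simpa using hzero h011
  · simpa using h100
  · simpa using hzero h101
  · simpa using hzero h110
  · simpa using h111

theorem Realization.norm_junk (h : R.merminValue = 4) : ‖R.junk‖ = 1 := by
  have h1 : ip R.state R.state = ip R.junk R.junk := by
    -- Pairing the state with an embedded component moves the embeddings over as adjoints and
    -- returns that component. Four nonzero terms, each a quarter of `‖junk‖²`, then sum to
    -- `‖junk‖²`.
    have hterm (i j k : Fin 2) :
        ip R.state (map3 (R.A.emb i) (R.B.emb j) (R.C.emb k) (R.comp i j k)) =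
        ip (R.comp i j k) (R.comp i j k) := by
      rw [ip, ← ContinuousLinearMap.adjoint_inner_left, adjoint_map3]
      rfl
    nth_rewrite 2 [R.state_eq_sum h]
    simp only [Fin.sum_univ_two]
    unfold ip at hterm ⊢
    simp only [inner_add_right, hterm]
    simp only [R.comp_eq_smul_junk h, inner_smul_left, inner_smul_right, inner_ket_zxState]
    simp [-inner_self_eq_norm_sq_to_K, Complex.conj_ofNat]
    ring
  rw [R.inner_state] at h1
  have h2 := inner_self_eq_norm_sq (𝕜 := ℂ) R.junk
  rw [← ip, ← h1, RCLike.one_re] at h2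
  nlinarith [norm_nonneg R.junk]

/-- The tensor product of the three local isometries. -/
noncomputable def Realization.isoMap : Tensor3 (Qubit ⊗[ℂ] R.A.frame) (Qubit ⊗[ℂ] R.B.frame)
    (Qubit ⊗[ℂ] R.C.frame) →L[ℂ] Tensor3 HA HB HC :=
  map3 R.A.frameIsometry.toContinuousLinearMap R.B.frameIsometry.toContinuousLinearMap
    R.C.frameIsometry.toContinuousLinearMap

theorem Realization.isoMap_zxState (h : R.merminValue = 4) :
    R.isoMap (withJunk zxState R.junk) = R.state := by
  conv_rhs => rw [R.state_eq_sum h]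
  simp only [withJunk, Realization.isoMap, map_sum, map_smul, map3_map3,
    BinaryMeasurements.frameIsometry_comp_mkL, R.comp_eq_smul_junk h]

theorem Realization.isoMap_eventProj (e : Event) (φ : Tensor3 Qubit Qubit Qubit)
    (junk : Tensor3 R.A.frame R.B.frame R.C.frame) :
    R.isoMap (withJunk (zxReference.eventProj e φ) junk) =
      R.eventProj e (R.isoMap (withJunk φ junk)) := by
  refine withJunk_intertwine (f := R.isoMap) (g := (R.eventProj e).comp R.isoMap) ?_ φ junk
  intro a b c k l m
  rw [ContinuousLinearMap.comp_apply, Realization.isoMap, Realization.eventProj, map3_tmul3,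
    map3_tmul3, map3_tmul3]
  simp only [LinearIsometry.coe_toContinuousLinearMap, BinaryMeasurements.proj_frameIsometry]
  rfl

theorem Realization.locallyEquivalent_zxReference (h : R.merminValue = 4) :
    LocallyEquivalent zxReference R := by
  refine ⟨R.A.frame, R.B.frame, R.C.frame, inferInstance, inferInstance, inferInstance,
    inferInstance, inferInstance, inferInstance, inferInstance, inferInstance, inferInstance,
    R.A.frameIsometry, R.B.frameIsometry, R.C.frameIsometry, R.junk, R.norm_junk h,
    R.isoMap_zxState h, fun e => ?_⟩
  refine (R.isoMap_eventProj e _ _).trans ?_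
  rw [show zxReference.state = zxState from rfl, R.isoMap_zxState h]

theorem map3_refUnitary_eventProj (e : Event) (φ : Tensor3 Qubit Qubit Qubit) :
    map3 (refUnitary : Qubit →L[ℂ] Qubit) (refUnitary : Qubit →L[ℂ] Qubit)
      (refUnitary : Qubit →L[ℂ] Qubit) (ghzReference.eventProj e φ) =
    zxReference.eventProj e (map3 (refUnitary : Qubit →L[ℂ] Qubit)
      (refUnitary : Qubit →L[ℂ] Qubit) (refUnitary : Qubit →L[ℂ] Qubit) φ) := by
  have h (l : Label) : (refUnitary : Qubit →L[ℂ] Qubit).comp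
      ((BinaryMeasurements.ofVectors xyVec orthonormal_xyVec).proj l) =
      ((BinaryMeasurements.ofVectors zxVec orthonormal_zxVec).proj l).comp
        (refUnitary : Qubit →L[ℂ] Qubit) := by
    ext1 x
    exact refUnitary_proj l x
  rw [Realization.eventProj, Realization.eventProj, map3_map3, map3_map3]
  have hmap := congr (congr (congrArg map3 (h e.1)) (h e.2.1)) (h e.2.2)
  exact congrArg (fun T => T φ) hmap

/-- The same junk state serves; each local isometry is precomposed with the reference unitary on its
qubit factor. -/
theorem Realization.locallyEquivalent_ghzReference (h : R.merminValue = 4) :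
    LocallyEquivalent ghzReference R := by
  have key (φ : Tensor3 Qubit Qubit Qubit) :
      map3 (R.A.frameIsometry.comp
          (refUnitary.toLinearIsometry.rTensor R.A.frame)).toContinuousLinearMap
        (R.B.frameIsometry.comp
          (refUnitary.toLinearIsometry.rTensor R.B.frame)).toContinuousLinearMap
        (R.C.frameIsometry.comp
          (refUnitary.toLinearIsometry.rTensor R.C.frame)).toContinuousLinearMap
        (withJunk φ R.junk) =
      R.isoMap (withJunk (map3 (refUnitary : Qubit →L[ℂ] Qubit)
        (refUnitary : Qubit →L[ℂ] Qubit) (refUnitary : Qubit →L[ℂ] Qubit) φ) R.junk) := by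
    refine (withJunk_intertwine (f := R.isoMap) ?_ φ R.junk).symm
    intro a b c k l m
    rw [Realization.isoMap, map3_tmul3, map3_tmul3]
    rfl
  refine ⟨R.A.frame, R.B.frame, R.C.frame, inferInstance, inferInstance, inferInstance,
    inferInstance, inferInstance, inferInstance, inferInstance, inferInstance, inferInstance,
    R.A.frameIsometry.comp (refUnitary.toLinearIsometry.rTensor R.A.frame),
    R.B.frameIsometry.comp (refUnitary.toLinearIsometry.rTensor R.B.frame),
    R.C.frameIsometry.comp (refUnitary.toLinearIsometry.rTensor R.C.frame),
    R.junk, R.norm_junk h, ?_, fun e => ?_⟩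
  · rw [key, show ghzReference.state = ghzState from rfl, map3_refUnitary_ghzState,
      R.isoMap_zxState h]
  · rw [key, map3_refUnitary_eventProj, show ghzReference.state = ghzState from rfl,
      map3_refUnitary_ghzState, R.isoMap_eventProj, R.isoMap_zxState h]

theorem zxReference_merminValue : zxReference.merminValue = 4 := by
  rw [← ghzReference_merminValue]
  refine Finset.sum_congr rfl fun i _ => ?_
  rw [Realization.prob, Realization.prob, show zxReference.state = zxState from rfl,
    ← map3_refUnitary_ghzState, ← map3_refUnitary_eventProj]
  exact congrArg Complex.re (inner_map3_isometry refUnitary.toLinearIsometry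
    refUnitary.toLinearIsometry refUnitary.toLinearIsometry _ _)

theorem merminSelfTests_ghzReference : MerminSelfTests.{u, v, w} ghzReference :=
  ⟨ghzReference_merminValue, fun _ _ _ => fun R h => R.locallyEquivalent_ghzReference h⟩

theorem merminSelfTests_zxReference : MerminSelfTests.{u, v, w} zxReference :=
  ⟨zxReference_merminValue, fun _ _ _ => fun R h => R.locallyEquivalent_zxReference h⟩

end SelfTest

end Mermin

open Mermin in
theorem mainTheorem7 :
    -- the graph of exclusivity, its independence number, and the local bound
    Nonempty (merminGraph ≃g shrikhandeGraphᶜ) ∧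
    merminGraph.indepNum = 3 ∧
    IsGreatest (Set.range localValue) 3 ∧
    -- the theta number and the quantum maximum
    IsGreatest (thetaValues ℝ merminGraph 1) 4 ∧
    IsGreatest (thetaValues ℂ merminGraph 1) 4 ∧
    IsGreatest quantumValues 4 ∧
    -- uniqueness of the primal optimum
    (∀ X, IsThetaOptimal ℝ merminGraph 1 X ↔ X = merminPrimal ℝ) ∧
    (∀ X, IsThetaOptimal ℂ merminGraph 1 X ↔ X = merminPrimal ℂ) ∧
    -- the primal optimum is realized by the GHZ state and Pauli measurements
    (∀ i j, merminPrimal ℂ i j = refEta i * refEta j * ip (refVec j) (refVec i)) ∧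
    ghzReference.momentMatrix = merminPrimal ℂ ∧
    (∀ i, ghzReference.eventProj (merminEvent i) ghzReference.state =
      refEta (some i) • refVec (some i)) ∧
    (∀ M ∈ ({ghzReference.A, ghzReference.B, ghzReference.C} : Set (BinaryMeasurements Qubit)),
      M.obs 0 = Matrix.toEuclideanCLM (n := Fin 2) (𝕜 := ℂ) (-pauliX) ∧
      M.obs 1 = Matrix.toEuclideanCLM (n := Fin 2) (𝕜 := ℂ) pauliY) ∧
    (∀ M ∈ ({zxReference.A, zxReference.B, zxReference.C} : Set (BinaryMeasurements Qubit)),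
      M.obs 0 = Matrix.toEuclideanCLM (n := Fin 2) (𝕜 := ℂ) pauliZ ∧
      M.obs 1 = Matrix.toEuclideanCLM (n := Fin 2) (𝕜 := ℂ) pauliX) ∧
    (∃ U : Qubit ≃ₗᵢ[ℂ] Qubit,
      map3 (U : Qubit →L[ℂ] Qubit) (U : Qubit →L[ℂ] Qubit) (U : Qubit →L[ℂ] Qubit)
        ghzReference.state = zxReference.state ∧
      ∀ l x, U (ghzReference.A.proj l x) = zxReference.A.proj l (U x)) ∧
    -- the conditions on the optimal product vectors, per party `(ℂ², xyVec)`
    Module.finrank ℂ (Submodule.span ℂ (Set.range refVec)) = 7 ∧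
    (∀ x, Module.finrank ℂ (Submodule.span ℂ
      ((fun p : Label × Label => xyVec p.1 ⊗ₜ[ℂ] xyVec p.2) '' pairsBC x)) = 3) ∧
    pairsBC lO = {(lO, lO), (lZ, lZ), (lM, lP), (lP, lM)} ∧
    pairsBC lP = {(lZ, lP), (lP, lZ), (lO, lM), (lM, lO)} ∧
    Submodule.span ℂ (xyVec '' {lO, lP}) = ⊤ ∧
    (graphA {lO, lP}).Connected ∧
    BipartiteCondition (pairsBC lO ∪ pairsBC lP) ∧
    Module.finrank ℂ Qubit = 2 ∧
    (Fintype.card Label = 4 ∧ ∀ l, ∃ l', ip (xyVec l) (xyVec l') = 0) ∧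
    -- the Mermin operator, and which realizations violate the inequality maximally
    (∀ (HA : Type u) (HB : Type v) (HC : Type w)
      [NormedAddCommGroup HA] [InnerProductSpace ℂ HA] [CompleteSpace HA]
      [NormedAddCommGroup HB] [InnerProductSpace ℂ HB] [CompleteSpace HB]
      [NormedAddCommGroup HC] [InnerProductSpace ℂ HC] [CompleteSpace HC]
      (R : Realization HA HB HC),
      R.merminExpectation = 2 * R.merminValue - 4 ∧ R.merminValue ≤ 4 ∧
      (R.merminValue = 4 ↔ IsThetaOptimal ℂ merminGraph 1 R.momentMatrix)) ∧
    -- self-testing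
    MerminSelfTests.{u, v, w} ghzReference ∧
    MerminSelfTests.{u, v, w} zxReference := by
  refine ⟨nonempty_iso_shrikhandeGraph_compl, indepNum_merminGraph, isGreatest_localValue,
    isGreatest_thetaValues posSemidef_merminPrimal_real,
    isGreatest_thetaValues posSemidef_merminPrimal_complex, isGreatest_quantumValues,
    fun _ => isThetaOptimal_iff posSemidef_merminPrimal_real,
    fun _ => isThetaOptimal_iff posSemidef_merminPrimal_complex,
    merminPrimal_eq_inner_refVec, ghzReference_momentMatrix, ghzReference_eventProj, ?_, ?_,
    ⟨refUnitary, map3_refUnitary_ghzState, refUnitary_proj⟩, finrank_span_refVec,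
    finrank_span_pairsBC, pairsBC_O, pairsBC_P, span_xyVec_pair (by decide), connected_graphA_O_P,
    bipartiteCondition_O_P, by simp, ⟨by simp, exists_inner_xyVec_eq_zero⟩, ?_,
    merminSelfTests_ghzReference, merminSelfTests_zxReference⟩
  · rintro M (rfl | rfl | rfl) <;>
      exact ⟨obs_ofVectors_xyVec_zero, obs_ofVectors_xyVec_one⟩
  · rintro M (rfl | rfl | rfl) <;>
      exact ⟨obs_ofVectors_zxVec_zero, obs_ofVectors_zxVec_one⟩
  · intro HA HB HC _ _ _ _ _ _ _ _ _ R
    exact ⟨R.merminExpectation_eq, R.merminValue_le, R.merminValue_eq_four_iff⟩
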